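/- Let $\mathcal M=(S,A,R,P,\rho_0)$ be a Markov decision process with countable state space $S$, countable action space $A$, bounded reward $R:S\to\mathbb R$, transition probabilities $P(s'\mid s,a)$ and initial distribution $\rho_0$. A policy $\pi$ (a probability distribution $\pi(s,\cdot)$ on $A$ for each state $s$) induces the Markov chain $M_\pi(s,s')=\sum_a\pi(s,a)P(s'\mid s,a)$, with marginals $\rho_\pi^{(0)}=\rho_0$, $\rho_\pi^{(t+1)}=\rho_\pi^{(t)}M_\pi$; a state $s$ is reachable under $\pi$ if $\rho^{(t)}_\pi(s)>0$ for some $t\ge1$. For a discounting function $\gamma:S\to[0,1]$ the product-form value function is $$Q_\pi(s,a)=\mathbb E_{s_1\sim P(\cdot\mid s,a),\ \{s_t\}_{t\ge2}\sim M_\pi}\Big[\sum_{t=1}^\infty R(s_t)\prod_{\tau=1}^{t-1}\gamma(s_\tau)\Big];$$ it is called well defined at $(s,a)$ if the series has finite absolute expectation, i.e. $\mathbb E\big[\sum_t |R(s_t)|\prod_{\tau<t}\gamma(s_\tau)\big]<\infty$. Assume that $\mathcal M$ is an episodic learning process: (i) $P(\cdot\mid s,a)=P(\cdot\mid s',a')$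 for all $a,a'\in A$ and all $s,s'$ with $\rho_0(s)\rho_0(s')>0$; let $S_\perp$, the set of terminal states, be the largest set containing $\{\rho_0>0\}$ with $P(\cdot\mid s,a)=P(\cdot\mid s',a')$ for all $s,s'\in S_\perp$, $a,a'\in A$; (ii) for every policy, the episodes (finite trajectory segments with at least one transition that start and end in $S_\perp$ and have no intermediate state in $S_\perp$), taken with their probabilities as the first episode of a rollout, have total probability $1$ and finite expected length. Let $0<\varepsilon<1$, let $s_0$ be a state with $\rho_0(s_0)>0$, and let $\mathcal M^+$ be the $\varepsilon$-perturbed model on $S^+=S\cup\{s_{null}\}$: from $s\in S_\perp$ it moves to $s_{null}$ with probability $\varepsilon$ and to $s'\in S$ with probability $(1-\varepsilon)P(s'\mid s,a)$; from $s\in S\setminus S_\perp$ it moves according to $P(\cdot\mid s,a)$; from $s_{null}$ it moves according to $P(\cdot\mid s_0,a)$; and $R(s_{null})=0$, $\rho_0(s_{null})=0$, $\gamma(s_{null})=1$. Let $\pi$ be a policy, extended arbitrarily to $s_{null}$. Then: 1. For every $\gamma:S\to[0,1]$ and all $(s,a)\in S\times A$, $Q_\pi$ is well defined at $(s,a)$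 in $\mathcal M$ if and only if the corresponding value $Q^+_\pi$ is well defined at $(s,a)$ in $\mathcal M^+$, and in that case $Q_\pi(s,a)=Q^+_\pi(s,a)$. 2. In $\mathcal M$ there is a unique stationary distribution $\rho_\pi=\rho_\pi M_\pi$ that vanishes at all states unreachable under $\pi$ (and it is the limiting distribution under $\pi$ whenever $\mathcal M$ has one). In $\mathcal M^+$ there is likewise a unique stationary distribution $\rho^+_\pi$ vanishing at unreachable states, and it is the limiting distribution $\lim_{t\to\infty}\rho^{+(t)}_\pi$. Moreover $\rho^+_\pi(s_{null})<1$, and $\rho_\pi\propto\rho_\pi^+$ on $S$; specifically $$\rho_\pi(s)=\frac{\rho^+_\pi(s)}{1-\rho^+_\pi(s_{null})}\qquad\text{for all } s\in S.$$ -/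

import Mathlib

open Filter Topology MeasureTheory ProbabilityTheory
open scoped ENNReal

noncomputable section

/-- A Markov decision process with state space `S` and action space `A` (countable in the
theorem): a bounded state reward, action-conditioned transition probabilities
`trans s a s' = P(s' | s, a)`, and an initial state distribution. -/
structure MDP (S A : Type*) where
  reward : S → ℝ
  reward_bounded : ∃ rmin rmax : ℝ, ∀ s, reward s ∈ Set.Icc rmin rmax
  trans : S → A → PMF S
  init : PMF S

/-- Mixture on `S ∪ {null}` (with `none` as the null state) putting mass `ε` on the null state
and `(1 - ε) * p s'` on each `s' : S`. -/
def PMF.detour {S : Type*} (p : PMF S) (ε : ℝ) (hε : ε ∈ Set.Ioo (0 : ℝ) 1) :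
    PMF (Option S) :=
  ⟨fun o => o.elim (ENNReal.ofReal ε) (fun s' => ENNReal.ofReal (1 - ε) * p s'), by
    rw [Summable.hasSum_iff ENNReal.summable,
      ← (Equiv.optionEquivSumPUnit.{0} S).symm.tsum_eq,
      Summable.tsum_sum ENNReal.summable ENNReal.summable]
    simp only [Equiv.optionEquivSumPUnit_symm_inl, Equiv.optionEquivSumPUnit_symm_inr,
      Option.elim, ENNReal.tsum_mul_left, p.tsum_coe, mul_one, tsum_fintype,
      Finset.univ_unique, Finset.sum_singleton]
    rw [← ENNReal.ofReal_add (by linarith [hε.2]) hε.1.le]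
    simp⟩

/-- The law of the trajectory `(ω 0, ω 1, …)` of the time-homogeneous Markov chain with
transition probabilities `K` and initial distribution `μ`; all subsets of the countable state
space are measurable. -/
def chainLaw {S : Type*} [Countable S] [MeasurableSpace S] [DiscreteMeasurableSpace S]
    (μ : PMF S) (K : S → PMF S) : Measure (ℕ → S) :=
  let κ : Kernel S S := Kernel.ofFunOfCountable fun s => (K s).toMeasure
  haveI : IsMarkovKernel κ := ⟨fun s => PMF.toMeasure.isProbabilityMeasure (K s)⟩
  Kernel.trajMeasure (X := fun _ => S) μ.toMeasure fun n =>
    κ.comap (fun h : (i : Finset.Iic n) → S => h ⟨n, Finset.mem_Iic.2 le_rfl⟩)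
      (measurable_pi_apply _)

namespace MDP

variable {S A : Type*} (M : MDP S A)

/-- The transition matrix `M_π(s, s') = ∑ a, π(s, a) P(s' | s, a)` of the Markov chain induced
by the policy `π`. -/
def chain (π : S → PMF A) (s : S) : PMF S := (π s).bind (M.trans s)

/-- The marginal distribution of the state at time `t` under the policy `π`. -/
def marginal (π : S → PMF A) : ℕ → PMF S
  | 0 => M.init
  | t + 1 => (marginal π t).bind (M.chain π)

/-- States reachable under `π`: those with positive probability at some time `t ≥ 1`. -/
def Reachable (π : S → PMF A) (s : S) : Prop := ∃ t ≥ 1, M.marginal π t s ≠ 0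

/-- `ρ` is a steady state of `π`: `ρ = ρ M_π`, and `ρ` vanishes at the unreachable states. -/
def IsSteady (π : S → PMF A) (ρ : PMF S) : Prop :=
  ρ.bind (M.chain π) = ρ ∧ ∀ s, ¬ M.Reachable π s → ρ s = 0

/-- `μ` is the limiting distribution under `π`. -/
def IsLimiting (π : S → PMF A) (μ : PMF S) : Prop :=
  ∀ s, Tendsto (fun t => M.marginal π t s) atTop (𝓝 (μ s))

/-- All initial states have identical and action-agnostic transition probabilities. -/
def Homogeneous : Prop :=
  ∀ s ∈ M.init.support, ∀ s' ∈ M.init.support, ∀ a a' : A, M.trans s a = M.trans s' a'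

/-- The terminal states: the states that share, for every action, the transition probabilities
of the initial states. -/
def terminals : Set S :=
  {s | ∀ s₀ ∈ M.init.support, ∀ a a' : A, M.trans s a = M.trans s₀ a'}

/-- In a homogeneous model, `terminals` is the largest set of states that contains the initial
states and whose members have identical and action-agnostic transition probabilities. -/
theorem isGreatest_terminals (h : M.Homogeneous) :
    IsGreatest {T : Set S | M.init.support ⊆ T ∧
      ∀ s ∈ T, ∀ s' ∈ T, ∀ a a' : A, M.trans s a = M.trans s' a'} M.terminals := by
  obtain ⟨s₀, h₀⟩ := M.init.support_nonempty
  refine ⟨⟨fun s hs s' hs' => h s hs s' hs', fun s hs s' hs' a a' => ?_⟩,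
    fun T hT s hs s' hs' => hT.2 s hs s' (hT.1 hs')⟩
  exact (hs s₀ h₀ a a).trans (hs' s₀ h₀ a' a).symm

/-- An episode: a trajectory segment `path 0, …, path length` with at least one transition
whose two end points are terminal and whose intermediate states are not. -/
structure Episode where
  length : ℕ
  length_pos : 0 < length
  path : Fin (length + 1) → S
  start_mem : path 0 ∈ M.terminals
  end_mem : path (Fin.last length) ∈ M.terminals
  mid_notMem : ∀ i, 0 < i → i < Fin.last length → path i ∉ M.terminals

/-- The probability that the first episode of a rollout of `π` is `ξ`. -/
def episodeProb (π : S → PMF A) (ξ : M.Episode) : ℝ≥0∞ :=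
  M.init (ξ.path 0) * ∏ i : Fin ξ.length, M.chain π (ξ.path i.castSucc) (ξ.path i.succ)

/-- An episodic learning process: homogeneity, and for every policy the episode probabilities
sum to one and the average episode length is finite. -/
structure IsEpisodic : Prop where
  homogeneous : M.Homogeneous
  sum_prob : ∀ π : S → PMF A, ∑' ξ, M.episodeProb π ξ = 1
  finite_length : ∀ π : S → PMF A, ∑' ξ, M.episodeProb π ξ * (ξ.length : ℝ≥0∞) < ⊤

open scoped Classical in
/-- The `ε`-perturbed model on `S ∪ {s_null} = Option S`, with `none` as `s_null`; here `s₀` is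
an initial state of `M`. The reward of `s_null` is `0`, and its initial probability is `0`. -/
def perturbed (ε : ℝ) (hε : ε ∈ Set.Ioo (0 : ℝ) 1) (s₀ : S) : MDP (Option S) A where
  reward o := o.elim 0 M.reward
  reward_bounded := by
    obtain ⟨l, u, h⟩ := M.reward_bounded
    refine ⟨min l 0, max u 0, fun o => ?_⟩
    cases o with
    | none => simp
    | some s => exact ⟨(min_le_left _ _).trans (h s).1, (h s).2.trans (le_max_left _ _)⟩
  trans o a :=
    match o with
    | none => (M.trans s₀ a).map some
    | some s => if s ∈ M.terminals then (M.trans s a).detour ε hε else (M.trans s a).map some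
  init := M.init.map some

section Value

variable [Countable S] (π : S → PMF A) (γ : S → ℝ) (s : S) (a : A)

/-- The `t`-th term `R(s_{t+1}) * ∏ τ ∈ {1, …, t}, γ(s_τ)` of the product-form return along the
trajectory `ω = (s_1, s_2, …)`. -/
def returnTerm (ω : ℕ → S) (t : ℕ) : ℝ := M.reward (ω t) * ∏ τ ∈ Finset.range t, γ (ω τ)

/-- The product-form value at `(s, a)` is well defined: the random series
`∑ t, R(s_t) * ∏ τ < t, γ(s_τ)`, where `s_1 ∼ P(s, a)` and then `M_π` is followed, has finite
absolute expectation. -/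
def ValueDefined : Prop :=
  letI : MeasurableSpace S := ⊤
  haveI : DiscreteMeasurableSpace S := ⟨fun _ => trivial⟩
  ∫⁻ ω, ∑' t, ‖M.returnTerm γ ω t‖ₑ ∂(chainLaw (M.trans s a) (M.chain π)) < ⊤

/-- The product-form value function
`Q_π(s, a) = E[∑_{t ≥ 1} R(s_t) * ∏_{1 ≤ τ ≤ t - 1} γ(s_τ)]`, where `s_1 ∼ P(s, a)` and then
`M_π` is followed. -/
def value : ℝ :=
  letI : MeasurableSpace S := ⊤
  haveI : DiscreteMeasurableSpace S := ⟨fun _ => trivial⟩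
  ∫ ω, ∑' t, M.returnTerm γ ω t ∂(chainLaw (M.trans s a) (M.chain π))

end Value

end MDP

end

/-!
The proof rests on two descriptions of a Markov chain, both in terms of transition matrices with
weighted rows.

*Values.* The expected return of a nonnegative reward is `potential`, the least solution of the
one-step equation `V = f + g * K V`. Passing through the null state multiplies the discount by one,
adds no reward, and is followed by the same law that the skipped exit from a terminal state would
have had. Hence the potential of each of the two chains, extended or restricted, solves the
equation of the other, so the potentials agree (`potential_detourChain_some`). Signed rewards are
split into positive and negative parts (`value_eq`).

*Steady states.* Every terminal state has the same exit law `q`, so the chain regenerates at its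
visits to the terminal states. Summing the probabilities of episodes by length shows that the
return time has finite mean (`MDP.IsEpisodic.cycleLength_ne_top`), so the occupation measure of one
cycle can be normalized to the stationary law `cycleLaw`. It is the only steady state: unrolling
`μ = μ K` along excursions from the terminal states exhausts `μ`, because excursions end almost
surely (`eq_cycleLaw_of_bind_eq`). A limiting distribution is steady by Fatou's lemma.

*Convergence.* A cycle of the perturbed chain is a cycle of the original chain, with one additional
visit to the null state with probability `ε`; the occupation measures thus agree on `S`
(`cycleMass_detourChain_some`), which gives the proportionality. The random delay also makes the
return time charge two consecutive integers, and then the renewal theorem (`tendsto_renewal`)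
yields convergence of the visit probabilities, and with it of the marginals
(`tendsto_chainDist_cycleLaw`). The renewal theorem is proved by taking limits along an ultrafilter
that realizes an extremal cluster point of the visit probabilities: the limits of the shifted
sequence are then harmonic and extremal at `0`, hence eventually constant, and the constant is found
from the total mass.
-/

noncomputable section

/-! ### Weighted transition operators -/

section Weighted

variable {X : Type*} (K : X → PMF X) (g : X → ℝ≥0∞)

/-- The action on masses `m` (row vectors) of the transition matrix `K` whose rows are weighted
by `g`: `y ↦ ∑ x, m x * g x * K(x, y)`. -/
def weightedPush : (X → ℝ≥0∞) →ₗ[ℝ≥0∞] (X → ℝ≥0∞) where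
  toFun m y := ∑' x, m x * g x * K x y
  map_add' m m' := by
    ext y
    simp only [Pi.add_apply, add_mul]
    exact ENNReal.tsum_add
  map_smul' c m := by
    ext y
    simp only [Pi.smul_apply, smul_eq_mul, RingHom.id_apply, mul_assoc, ENNReal.tsum_mul_left]

/-- The action on functions `h` (column vectors) of the transition matrix `K` whose rows are
weighted by `g`: `x ↦ g x * ∑ y, K(x, y) * h y`. -/
def weightedPull (h : X → ℝ≥0∞) (x : X) : ℝ≥0∞ := g x * ∑' y, K x y * h y

theorem weightedPush_apply (m : X → ℝ≥0∞) (y : X) :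
    weightedPush K g m y = ∑' x, m x * g x * K x y := rfl

theorem tsum_weightedPush_mul (m h : X → ℝ≥0∞) :
    ∑' y, weightedPush K g m y * h y = ∑' x, m x * weightedPull K g h x := by
  simp only [weightedPush_apply, weightedPull, ← ENNReal.tsum_mul_right]
  rw [ENNReal.tsum_comm]
  simp only [← ENNReal.tsum_mul_left, mul_assoc]

theorem tsum_weightedPush_pow_mul (n : ℕ) (m h : X → ℝ≥0∞) :
    ∑' y, (weightedPush K g ^ n) m y * h y = ∑' x, m x * (weightedPull K g)^[n] h x := by
  induction n generalizing m with
  | zero => simp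
  | succ n ih =>
    rw [pow_succ, Module.End.mul_apply, ih, tsum_weightedPush_mul, Function.iterate_succ_apply']

theorem weightedPull_mono {h h' : X → ℝ≥0∞} (hh : h ≤ h') :
    weightedPull K g h ≤ weightedPull K g h' := fun x => by
  unfold weightedPull
  gcongr with y
  exact hh y

theorem weightedPull_tsum (h : ℕ → X → ℝ≥0∞) (x : X) :
    weightedPull K g (fun y => ∑' n, h n y) x = ∑' n, weightedPull K g (h n) x := by
  simp only [weightedPull]
  rw [ENNReal.tsum_mul_left, ENNReal.tsum_comm]
  simp only [← ENNReal.tsum_mul_left]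

/-- The expected total `f`-return along the chain `K` from a given state, discounted by `g` at
each visited state. -/
def potential (f : X → ℝ≥0∞) (x : X) : ℝ≥0∞ := ∑' n, (weightedPull K g)^[n] f x

theorem potential_eq (f : X → ℝ≥0∞) (x : X) :
    potential K g f x = f x + weightedPull K g (potential K g f) x := by
  rw [potential, tsum_eq_zero_add' ENNReal.summable]
  unfold potential
  rw [weightedPull_tsum]
  simp only [Function.iterate_succ_apply', Function.iterate_zero, id]

/-- The potential is the least solution of its one-step equation. -/
theorem potential_le {f U : X → ℝ≥0∞} (hU : ∀ x, f x + weightedPull K g U x ≤ U x) (x : X) :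
    potential K g f x ≤ U x := by
  have key : ∀ N x, ∑ n ∈ Finset.range N, (weightedPull K g)^[n] f x ≤ U x := by
    intro N
    induction N with
    | zero => simp
    | succ N ih =>
      intro x
      refine le_trans ?_ (hU x)
      rw [Finset.sum_range_succ', add_comm]
      simp only [Function.iterate_zero, id]
      gcongr
      calc ∑ n ∈ Finset.range N, (weightedPull K g)^[n + 1] f x
          = weightedPull K g (fun y => ∑ n ∈ Finset.range N, (weightedPull K g)^[n] f y) x := by
            simp only [Function.iterate_succ_apply', weightedPull, Finset.mul_sum]
            rw [Summable.tsum_finsetSum fun _ _ => ENNReal.summable, Finset.mul_sum]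
        _ ≤ _ := weightedPull_mono K g ih x
  rw [potential, ENNReal.tsum_eq_iSup_nat]
  exact iSup_le fun N => key N x

end Weighted

/-! ### Expected returns along a trajectory -/

section ChainLaw

variable {X : Type*} [Countable X] [MeasurableSpace X] [DiscreteMeasurableSpace X]

theorem PMF.lintegral_toMeasure_eq_tsum (p : PMF X) (h : X → ℝ≥0∞) :
    ∫⁻ x, h x ∂p.toMeasure = ∑' x, p x * h x := by
  rw [lintegral_countable']
  exact tsum_congr fun x => by
    rw [PMF.toMeasure_apply_singleton _ _ (measurableSet_singleton x), mul_comm]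

/-- The Markov property: given the first `n + 1` states, the state at time `n + 1` is distributed
according to the row of `K` at the current state. -/
theorem lintegral_chainLaw_succ (μ : PMF X) (K : X → PMF X) (n : ℕ)
    (F : ((i : Finset.Iic n) → X) → ℝ≥0∞) (h : X → ℝ≥0∞) (hF : Measurable F) :
    ∫⁻ ω, F (Preorder.frestrictLe n ω) * h (ω (n + 1)) ∂chainLaw μ K =
      ∫⁻ ω, F (Preorder.frestrictLe n ω) * ∑' y, K (ω n) y * h y ∂chainLaw μ K := by
  have hh : Measurable h := measurable_of_countable h
  unfold chainLaw
  set κ : Kernel X X := Kernel.ofFunOfCountable fun s => (K s).toMeasure with hκ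
  have : IsMarkovKernel κ := ⟨fun s => PMF.toMeasure.isProbabilityMeasure (K s)⟩
  have := PMF.toMeasure.isProbabilityMeasure μ
  set η : (n : ℕ) → Kernel ((i : Finset.Iic n) → X) X := fun n =>
    κ.comap (fun h : (i : Finset.Iic n) → X => h ⟨n, Finset.mem_Iic.2 le_rfl⟩)
      (measurable_pi_apply _) with hη
  have key := Kernel.map_frestrictLe_trajMeasure_compProd_eq_map_trajMeasure
    (X := fun _ => X) (κ := η) (μ₀ := μ.toMeasure) (a := n)
  have h1 : Measurable fun z : ((i : Finset.Iic n) → X) × X => F z.1 * h z.2 := by fun_prop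
  have h2 := congrArg (fun m => ∫⁻ z, F z.1 * h z.2 ∂m) key
  beta_reduce at h2
  rw [lintegral_map h1 (by fun_prop), Measure.lintegral_compProd h1] at h2
  refine h2.symm.trans ?_
  rw [lintegral_map (Measurable.lintegral_kernel_prod_right' h1) (by fun_prop)]
  refine lintegral_congr fun ω => ?_
  refine (lintegral_const_mul (μ := η n (Preorder.frestrictLe n ω))
    (F (Preorder.frestrictLe n ω)) hh).trans ?_
  congr 1
  exact PMF.lintegral_toMeasure_eq_tsum _ _

theorem lintegral_chainLaw_zero (μ : PMF X) (K : X → PMF X) (h : X → ℝ≥0∞) :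
    ∫⁻ ω, h (ω 0) ∂chainLaw μ K = ∑' x, μ x * h x := by
  have hh : Measurable h := measurable_of_countable h
  have h0 : Measurable fun ω : ℕ → X => h (ω 0) := hh.comp (measurable_pi_apply 0)
  unfold chainLaw
  set κ : Kernel X X := Kernel.ofFunOfCountable fun s => (K s).toMeasure with hκ
  have : IsMarkovKernel κ := ⟨fun s => PMF.toMeasure.isProbabilityMeasure (K s)⟩
  have := PMF.toMeasure.isProbabilityMeasure μ
  rw [← PMF.lintegral_toMeasure_eq_tsum, Kernel.trajMeasure,
    Measure.lintegral_bind (Kernel.aemeasurable _) h0.aemeasurable,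
    lintegral_map (Measurable.lintegral_kernel h0) (by fun_prop)]
  refine lintegral_congr fun x => ?_
  rw [Kernel.lintegral_traj _ h0]
  simp [Function.updateFinset]

/-- The expectation of a product-form term, as an iterate of the weighted transition matrix. -/
theorem lintegral_chainLaw_prod_mul (μ : PMF X) (K : X → PMF X) (g h : X → ℝ≥0∞) (n : ℕ) :
    ∫⁻ ω, (∏ τ ∈ Finset.range n, g (ω τ)) * h (ω n) ∂chainLaw μ K =
      ∑' x, μ x * (weightedPull K g)^[n] h x := by
  induction n generalizing h with
  | zero => simpa using lintegral_chainLaw_zero μ K h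
  | succ n ih =>
    have hg : Measurable g := measurable_of_countable g
    have := lintegral_chainLaw_succ μ K n
      (fun x => ∏ τ : Finset.Iic n, g (x τ)) h (by fun_prop)
    have e : ∀ ω : ℕ → X, ∏ τ : Finset.Iic n, g (Preorder.frestrictLe n ω τ) =
        ∏ τ ∈ Finset.range (n + 1), g (ω τ) := fun ω => by
      rw [Finset.univ_eq_attach]
      exact (Finset.prod_attach (Finset.Iic n) fun τ => g (ω τ)).trans
        (Finset.prod_congr (by ext; simp) fun _ _ => rfl)
    simp only [e] at this
    rw [this, Function.iterate_succ_apply, ← ih]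
    refine lintegral_congr fun ω => ?_
    rw [Finset.prod_range_succ, mul_assoc]
    rfl

theorem lintegral_chainLaw_tsum (μ : PMF X) (K : X → PMF X) (g f : X → ℝ≥0∞) :
    ∫⁻ ω, ∑' n, (∏ τ ∈ Finset.range n, g (ω τ)) * f (ω n) ∂chainLaw μ K =
      ∑' x, μ x * potential K g f x := by
  have hg : Measurable g := measurable_of_countable g
  have hf : Measurable f := measurable_of_countable f
  rw [lintegral_tsum fun n => by fun_prop]
  simp only [lintegral_chainLaw_prod_mul, potential, ← ENNReal.tsum_mul_left]
  rw [ENNReal.tsum_comm]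

end ChainLaw

/-! ### Regenerative Markov chains -/

theorem ENNReal.tendsto_tsum_mul_zero {X : Type*} {μ : X → ℝ≥0∞} (hμ : ∑' x, μ x ≠ ⊤)
    {h : ℕ → X → ℝ≥0∞} (hb : ∀ n x, h n x ≤ 1)
    (hlim : ∀ x, μ x ≠ 0 → Tendsto (fun n => h n x) atTop (𝓝 0)) :
    Tendsto (fun n => ∑' x, μ x * h n x) atTop (𝓝 0) := by
  let _ : MeasurableSpace X := ⊤
  have : DiscreteMeasurableSpace X := ⟨fun _ => trivial⟩
  have key := tendsto_lintegral_of_dominated_convergence (μ := Measure.count)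
    (F := fun n x => μ x * h n x) (f := fun _ => 0) μ
    (fun n => measurable_from_top)
    (fun n => Eventually.of_forall fun x => mul_le_of_le_one_right' (hb n x))
    (by rwa [lintegral_count]) (Eventually.of_forall fun x => ?_)
  · simpa only [lintegral_count, tsum_zero] using key
  · by_cases hx : μ x = 0
    · simp [hx]
    · simpa using ENNReal.Tendsto.const_mul (hlim x hx)
        (Or.inr (ENNReal.ne_top_of_tsum_ne_top hμ x))

section Regenerative

variable {X : Type*} (K : X → PMF X) (T : Set X) (q : PMF X)

/-- The distribution at time `n` of the chain `K` started from `q`, restricted to the event that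
`T` has not been visited at the times `0, …, n - 1`. -/
def tabooMass (n : ℕ) : X → ℝ≥0∞ := (weightedPush K (Tᶜ.indicator 1) ^ n) q

/-- The distribution at time `n` of the chain `K` started from `q`. -/
def chainDist : ℕ → PMF X
  | 0 => q
  | n + 1 => (chainDist n).bind K

/-- The probability that the chain which enters `T` at time `0` and moves from there according
to `q` is in `T` at time `n`. -/
def visitProb : ℕ → ℝ≥0∞
  | 0 => 1
  | n + 1 => ∑' x, T.indicator (chainDist K q n) x

theorem tabooMass_zero : tabooMass K T q 0 = q := rfl

theorem tabooMass_succ (n : ℕ) :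
    tabooMass K T q (n + 1) = weightedPush K (Tᶜ.indicator 1) (tabooMass K T q n) := by
  rw [tabooMass, pow_succ', Module.End.mul_apply, tabooMass]

theorem indicator_add_mul_indicator_compl (m : X → ℝ≥0∞) (x : X) :
    m x * Tᶜ.indicator 1 x + T.indicator m x = m x := by
  by_cases hx : x ∈ T <;> simp [hx]

theorem tsum_weightedPush_taboo (m : X → ℝ≥0∞) :
    ∑' y, weightedPush K (Tᶜ.indicator 1) m y + ∑' x, T.indicator m x = ∑' x, m x := by
  have := tsum_weightedPush_mul K (Tᶜ.indicator 1) m 1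
  simp only [Pi.one_apply, mul_one, weightedPull, PMF.tsum_coe] at this
  rw [this, ← ENNReal.tsum_add]
  exact tsum_congr fun x => indicator_add_mul_indicator_compl T m x

variable {K T q}

/-- One step of a chain that regenerates in `T`: mass outside `T` moves by the taboo kernel, and
mass in `T` is redistributed according to `q`. -/
theorem tsum_mul_eq_push_add (hK : ∀ x ∈ T, K x = q) (m : X → ℝ≥0∞) (y : X) :
    ∑' x, m x * K x y =
      weightedPush K (Tᶜ.indicator 1) m y + (∑' x, T.indicator m x) * q y := by
  rw [weightedPush_apply, ← ENNReal.tsum_mul_right, ← ENNReal.tsum_add]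
  refine tsum_congr fun x => ?_
  by_cases hx : x ∈ T
  · simp [hx, hK x hx]
  · simp [hx]

/-- Decomposition of the distribution at time `n` by the time of the last visit to `T`. -/
theorem chainDist_eq_sum (hK : ∀ x ∈ T, K x = q) (n : ℕ) :
    (chainDist K q n : X → ℝ≥0∞) =
      ∑ k ∈ Finset.range (n + 1), visitProb K T q (n - k) • tabooMass K T q k := by
  induction n with
  | zero => simp [chainDist, visitProb, tabooMass_zero]
  | succ n ih =>
    have h1 : (chainDist K q (n + 1) : X → ℝ≥0∞) =
        weightedPush K (Tᶜ.indicator 1) (chainDist K q n) + visitProb K T q (n + 1) • ⇑q := by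
      ext y
      exact tsum_mul_eq_push_add hK _ y
    rw [h1, ih, map_sum, Finset.sum_range_succ' _ (n + 1), tabooMass_zero, Nat.sub_zero]
    simp only [map_smul, ← tabooMass_succ, Nat.add_sub_add_right]

theorem chainDist_apply_eq_sum (hK : ∀ x ∈ T, K x = q) (n : ℕ) (x : X) :
    chainDist K q n x =
      ∑ k ∈ Finset.range (n + 1), visitProb K T q (n - k) * tabooMass K T q k x := by
  rw [chainDist_eq_sum hK]
  simp

theorem tabooMass_le_chainDist (hK : ∀ x ∈ T, K x = q) (n : ℕ) (x : X) :
    tabooMass K T q n x ≤ chainDist K q n x := by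
  rw [chainDist_apply_eq_sum hK]
  refine le_trans ?_ (Finset.single_le_sum (fun _ _ => zero_le) (Finset.self_mem_range_succ n))
  simp [visitProb]

theorem exists_tabooMass_ne_zero_iff (hK : ∀ x ∈ T, K x = q) (x : X) :
    (∃ n, tabooMass K T q n x ≠ 0) ↔ ∃ n, chainDist K q n x ≠ 0 := by
  constructor
  · rintro ⟨n, hn⟩
    exact ⟨n, fun h => hn (le_zero_iff.1 (h ▸ tabooMass_le_chainDist hK n x))⟩
  · rintro ⟨n, hn⟩
    rw [chainDist_apply_eq_sum hK] at hn
    obtain ⟨k, -, hk⟩ := Finset.exists_ne_zero_of_sum_ne_zero hn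
    exact ⟨k, right_ne_zero_of_mul hk⟩

theorem tsum_tabooMass_add_sum (n : ℕ) :
    ∑' x, tabooMass K T q n x +
      ∑ k ∈ Finset.range n, ∑' x, T.indicator (tabooMass K T q k) x = 1 := by
  induction n with
  | zero => simp [tabooMass_zero]
  | succ n ih =>
    rw [Finset.sum_range_succ, ← ih, ← tsum_weightedPush_taboo K T (tabooMass K T q n),
      ← tabooMass_succ]
    ring

theorem tsum_tabooMass_le_one (n : ℕ) : ∑' x, tabooMass K T q n x ≤ 1 := by
  rw [← tsum_tabooMass_add_sum (K := K) (T := T) (q := q) n]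
  exact le_self_add

theorem tabooMass_ne_top (n : ℕ) (x : X) : tabooMass K T q n x ≠ ⊤ :=
  ENNReal.ne_top_of_tsum_ne_top
    (ne_top_of_le_ne_top ENNReal.one_ne_top (tsum_tabooMass_le_one n)) x

variable (K T q) in
/-- The expected time between two successive visits of the chain to `T`, when it moves from `T`
according to `q`: the sum over `n` of the probabilities that `T` is not visited in the first `n`
steps. -/
def cycleLength : ℝ≥0∞ := ∑' n, ∑' x, tabooMass K T q n x

theorem tendsto_tsum_tabooMass (hfin : cycleLength K T q ≠ ⊤) :
    Tendsto (fun n => ∑' x, tabooMass K T q n x) atTop (𝓝 0) :=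
  ENNReal.tendsto_atTop_zero_of_tsum_ne_top hfin

/-- Finite mean return times force recurrence. -/
theorem tsum_tsum_indicator_tabooMass (hfin : cycleLength K T q ≠ ⊤) :
    ∑' n, ∑' x, T.indicator (tabooMass K T q n) x = 1 := by
  have h1 := (tendsto_tsum_tabooMass hfin).add
    (ENNReal.tendsto_nat_tsum fun n => ∑' x, T.indicator (tabooMass K T q n) x)
  simp only [tsum_tabooMass_add_sum, zero_add] at h1
  exact tendsto_nhds_unique h1 tendsto_const_nhds

variable (K T q) in
/-- The expected number of visits to `x` between two successive visits to `T`, the second one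
included. -/
def cycleMass (x : X) : ℝ≥0∞ := ∑' n, tabooMass K T q n x

theorem tsum_cycleMass : ∑' x, cycleMass K T q x = cycleLength K T q := ENNReal.tsum_comm

theorem cycleLength_ne_zero : cycleLength K T q ≠ 0 := by
  have h : (1 : ℝ≥0∞) ≤ cycleLength K T q := by
    refine le_trans ?_ (ENNReal.le_tsum 0)
    simp [tabooMass_zero]
  exact fun h0 => by simp [h0] at h

theorem cycleMass_ne_top (hfin : cycleLength K T q ≠ ⊤) (x : X) : cycleMass K T q x ≠ ⊤ :=
  ENNReal.ne_top_of_tsum_ne_top (tsum_cycleMass.trans_ne hfin) x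

/-- The normalized occupation measure of a cycle. -/
def cycleLaw (hfin : cycleLength K T q ≠ ⊤) : PMF X :=
  PMF.normalize (cycleMass K T q) (tsum_cycleMass.trans_ne cycleLength_ne_zero)
    (tsum_cycleMass.trans_ne hfin)

theorem cycleLaw_apply (hfin : cycleLength K T q ≠ ⊤) (x : X) :
    cycleLaw hfin x = cycleMass K T q x * (cycleLength K T q)⁻¹ := by
  rw [cycleLaw, PMF.normalize_apply, tsum_cycleMass]

theorem cycleLaw_eq_zero (hfin : cycleLength K T q ≠ ⊤) {x : X}
    (hx : ∀ n, tabooMass K T q n x = 0) : cycleLaw hfin x = 0 := by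
  rw [cycleLaw_apply, cycleMass]
  simp [hx]

theorem cycleMass_stationary (hK : ∀ x ∈ T, K x = q) (hfin : cycleLength K T q ≠ ⊤) (y : X) :
    ∑' x, cycleMass K T q x * K x y = cycleMass K T q y := by
  have h1 : ∑' x, T.indicator (cycleMass K T q) x = 1 := by
    rw [← tsum_tsum_indicator_tabooMass hfin, ENNReal.tsum_comm]
    refine tsum_congr fun x => ?_
    by_cases hx : x ∈ T <;> simp [hx, cycleMass]
  have h2 : weightedPush K (Tᶜ.indicator 1) (cycleMass K T q) y =
      ∑' n, tabooMass K T q (n + 1) y := by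
    simp only [tabooMass_succ, weightedPush_apply, cycleMass, ← ENNReal.tsum_mul_right]
    exact ENNReal.tsum_comm
  rw [tsum_mul_eq_push_add hK, h1, h2, one_mul, cycleMass,
    tsum_eq_zero_add' (f := fun n => tabooMass K T q n y) ENNReal.summable, tabooMass_zero,
    add_comm]

theorem cycleLaw_bind (hK : ∀ x ∈ T, K x = q) (hfin : cycleLength K T q ≠ ⊤) :
    (cycleLaw hfin).bind K = cycleLaw hfin := by
  ext y
  rw [PMF.bind_apply]
  simp only [cycleLaw_apply, mul_right_comm _ _ (K _ _), ENNReal.tsum_mul_right]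
  rw [cycleMass_stationary hK hfin]

/-- From a state that is charged by the cycle measure, the chain almost surely returns to `T`. -/
theorem tendsto_weightedPull_iterate_zero (hfin : cycleLength K T q ≠ ⊤) {x : X} {k : ℕ}
    (hx : tabooMass K T q k x ≠ 0) :
    Tendsto (fun n => (weightedPull K (Tᶜ.indicator 1))^[n] 1 x) atTop (𝓝 0) := by
  have hle : ∀ n, tabooMass K T q k x * (weightedPull K (Tᶜ.indicator 1))^[n] 1 x ≤
      ∑' y, tabooMass K T q (n + k) y := fun n => by
    have := tsum_weightedPush_pow_mul K (Tᶜ.indicator 1) n (tabooMass K T q k) 1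
    simp only [Pi.one_apply, mul_one] at this
    have e : tabooMass K T q (n + k) =
        (weightedPush K (Tᶜ.indicator 1) ^ n) (tabooMass K T q k) := by
      simp only [tabooMass, pow_add, Module.End.mul_apply]
    rw [e, this]
    exact ENNReal.le_tsum (f := fun x =>
      tabooMass K T q k x * (weightedPull K (Tᶜ.indicator 1))^[n] 1 x) x
  have hlim := (tendsto_tsum_tabooMass hfin).comp (tendsto_add_atTop_nat k)
  have h0 : Tendsto (fun n => tabooMass K T q k x *
      (weightedPull K (Tᶜ.indicator 1))^[n] 1 x) atTop (𝓝 0) :=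
    tendsto_of_tendsto_of_tendsto_of_le_of_le tendsto_const_nhds hlim (fun _ => zero_le) hle
  have h1 := ENNReal.Tendsto.const_mul (a := (tabooMass K T q k x)⁻¹) h0
    (Or.inr (ENNReal.inv_ne_top.2 hx))
  simpa only [mul_zero, ← mul_assoc, ENNReal.inv_mul_cancel hx (tabooMass_ne_top k x),
    one_mul] using h1

theorem weightedPull_iterate_le_one (n : ℕ) (x : X) :
    (weightedPull K (Tᶜ.indicator 1))^[n] 1 x ≤ 1 := by
  induction n generalizing x with
  | zero => simp
  | succ n ih =>
    rw [Function.iterate_succ_apply', weightedPull]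
    refine mul_le_one' ?_ ?_
    · by_cases hx : x ∈ T <;> simp [hx]
    · calc _ ≤ ∑' y, K x y * 1 := by gcongr with y; exact ih y
        _ = 1 := by simp

/-- A stationary distribution carried by the states that the chain visits from `T` is the cycle
law: unrolling stationarity along excursions from `T` writes it as a multiple of a truncated
cycle measure plus the mass of the excursions that have not ended, which tends to zero. -/
theorem eq_cycleLaw_of_bind_eq (hK : ∀ x ∈ T, K x = q) (hfin : cycleLength K T q ≠ ⊤)
    {μ : PMF X} (hμ : μ.bind K = μ) (hsupp : ∀ x, (∀ n, tabooMass K T q n x = 0) → μ x = 0) :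
    μ = cycleLaw hfin := by
  set c := ∑' x, T.indicator μ x
  set Φ := weightedPush K (Tᶜ.indicator 1)
  have hstep : (μ : X → ℝ≥0∞) = Φ μ + c • ⇑q := by
    ext y
    conv_lhs => rw [← hμ]
    exact tsum_mul_eq_push_add hK μ y
  have hunroll : ∀ n, (μ : X → ℝ≥0∞) =
      c • ∑ k ∈ Finset.range n, tabooMass K T q k + (Φ ^ n) μ := by
    intro n
    induction n with
    | zero => simp
    | succ n ih =>
      have : (Φ ^ n) μ = (Φ ^ (n + 1)) μ + c • tabooMass K T q n := by
        conv_lhs => rw [hstep]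
        rw [map_add, map_smul, pow_succ, Module.End.mul_apply, tabooMass]
      rw [Finset.sum_range_succ, smul_add, add_assoc, add_comm (c • tabooMass K T q n), ← this]
      exact ih
  have hrest : Tendsto (fun n => ∑' x, (Φ ^ n) μ x) atTop (𝓝 0) := by
    have h := fun n => tsum_weightedPush_pow_mul K (Tᶜ.indicator 1) n μ 1
    simp only [Pi.one_apply, mul_one] at h
    simp only [Φ, h]
    refine ENNReal.tendsto_tsum_mul_zero μ.tsum_coe_ne_top weightedPull_iterate_le_one
      fun x hx => ?_
    have : ∃ k, tabooMass K T q k x ≠ 0 := by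
      by_contra! h0
      exact hx (hsupp x h0)
    obtain ⟨k, hk⟩ := this
    exact tendsto_weightedPull_iterate_zero hfin hk
  have hc : c ≠ ⊤ := μ.tsum_coe_indicator_ne_top T
  have heq : ∀ x, μ x = c * cycleMass K T q x := by
    intro x
    have h1 : Tendsto (fun n => (Φ ^ n) μ x) atTop (𝓝 0) :=
      tendsto_of_tendsto_of_tendsto_of_le_of_le tendsto_const_nhds hrest (fun _ => zero_le)
        fun n => ENNReal.le_tsum x
    have h2 := (ENNReal.Tendsto.const_mul (ENNReal.tendsto_nat_tsum fun n =>
      tabooMass K T q n x) (Or.inr hc)).add h1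
    rw [add_zero] at h2
    refine tendsto_nhds_unique (tendsto_const_nhds (x := μ x)) (h2.congr fun n => ?_)
    have := congrFun (hunroll n) x
    simpa using this.symm
  have hone : c * cycleLength K T q = 1 := by
    rw [← tsum_cycleMass, ← ENNReal.tsum_mul_left, ← μ.tsum_coe]
    exact tsum_congr fun x => (heq x).symm
  ext x
  rw [cycleLaw_apply, heq, mul_comm, ENNReal.eq_inv_of_mul_eq_one_left hone]

end Regenerative

/-! ### The renewal theorem -/

/-- Passage to the limit in a convolution with a summable sequence, along any filter that
describes the limits of all the backward shifts of `u`. -/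
theorem tendsto_convolution_of_tendsto_shift {F : Filter ℕ} (hF : F ≤ atTop) {u v w : ℕ → ℝ}
    (hu : ∀ n, u n ∈ Set.Icc (0 : ℝ) 1) (hw : ∀ n, 0 ≤ w n) (hws : Summable w)
    (hv : ∀ d, Tendsto (fun n => u (n - d)) F (𝓝 (v d))) (d : ℕ) :
    Tendsto (fun n => ∑ k ∈ Finset.range (n - d + 1), w k * u (n - d - k)) F
      (𝓝 (∑' k, w k * v (d + k))) := by
  have key := tendsto_tsum_of_dominated_convergence (𝓕 := F)
    (f := fun n k => if k ∈ Finset.range (n - d + 1) then w k * u (n - d - k) else 0)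
    (g := fun k => w k * v (d + k)) (bound := w) hws (fun k => ?_)
    (Eventually.of_forall fun n k => ?_)
  · refine key.congr fun n => ?_
    rw [tsum_eq_sum (s := Finset.range (n - d + 1)) fun k hk => if_neg hk]
    exact Finset.sum_congr rfl fun k hk => if_pos hk
  · refine ((hv (d + k)).const_mul (w k)).congr' ?_
    filter_upwards [hF (eventually_ge_atTop (d + k))] with n hn
    rw [if_pos (Finset.mem_range.2 (by omega)), Nat.sub_sub]
  · split_ifs
    · rw [Real.norm_of_nonneg (mul_nonneg (hw k) (hu _).1)]
      exact mul_le_of_le_one_right (hw k) (hu _).2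
    · simpa using hw k

/-- The maximum principle for averages over an aperiodic distribution: a sequence `v` with
`v d = ∑ k, a k * v (d + k + 1)` that is maximal at `0` is eventually constant. -/
theorem eq_of_harmonic_of_le {a v : ℕ → ℝ} (ha : ∀ n, 0 ≤ a n) (hasum : HasSum a 1)
    {C : ℝ} (hC : ∀ d, |v d| ≤ C) (hv : ∀ d, v d = ∑' k, a k * v (d + k + 1))
    (hmax : ∀ d, v d ≤ v 0) {k : ℕ} (hk : a k ≠ 0) (hk' : a (k + 1) ≠ 0) {d : ℕ}
    (hd : (k + 1) * (k + 1) ≤ d) : v d = v 0 := by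
  have step : ∀ d j, a j ≠ 0 → v d = v 0 → v (d + (j + 1)) = v 0 := by
    intro d j hj hd
    have hs : Summable fun k => a k * v (d + k + 1) := by
      refine Summable.of_norm_bounded (hasum.summable.mul_right C) fun k => ?_
      rw [norm_mul, Real.norm_of_nonneg (ha k)]
      exact mul_le_mul_of_nonneg_left (hC _) (ha k)
    have h0 : HasSum (fun k => a k * (v 0 - v (d + k + 1))) 0 := by
      have := (hasum.mul_right (v 0)).sub hs.hasSum
      rw [← hv, hd, one_mul, sub_self] at this
      simpa only [mul_sub] using this
    have h1 := (hasSum_zero_iff_of_nonneg fun k =>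
      mul_nonneg (ha k) (sub_nonneg.2 (hmax _))).1 h0
    have h2 := (mul_eq_zero.1 (congrFun h1 j)).resolve_left hj
    rw [← add_assoc]
    linarith
  have iter : ∀ i j, v (i * (k + 1) + j * (k + 1 + 1)) = v 0 := by
    intro i j
    induction j with
    | zero =>
      induction i with
      | zero => simp
      | succ i ih =>
        have := step _ k hk ih
        rwa [show i * (k + 1) + 0 * (k + 1 + 1) + (k + 1) =
          (i + 1) * (k + 1) + 0 * (k + 1 + 1) by ring] at this
    | succ j ih =>
      have := step _ (k + 1) hk' ih
      rwa [show i * (k + 1) + j * (k + 1 + 1) + (k + 1 + 1) =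
        i * (k + 1) + (j + 1) * (k + 1 + 1) by ring] at this
  -- With `d = (k + 1) * c + r` and `r < k + 1 ≤ c`, take `c - r` steps `k + 1` and `r` steps `k + 2`.
  have hr := Nat.mod_lt d (Nat.succ_pos k)
  have hc : k + 1 ≤ d / (k + 1) := (Nat.le_div_iff_mul_le (Nat.succ_pos k)).2 hd
  have hdm := Nat.div_add_mod d (k + 1)
  obtain ⟨e, he⟩ : ∃ e, d / (k + 1) = e + d % (k + 1) :=
    ⟨d / (k + 1) - d % (k + 1), by rw [Nat.succ_eq_add_one] at *; omega⟩
  have := iter e (d % (k + 1))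
  rwa [show e * (k + 1) + d % (k + 1) * (k + 1 + 1) = d by
    rw [he] at hdm
    linarith [hdm]] at this

/-- The renewal theorem of Erdős, Feller and Pollard, for a distribution `a` that charges two
consecutive integers; `r` is the sequence of its tails, whose sum is the mean of `a`. -/
theorem tendsto_renewal {a r u : ℕ → ℝ} (ha : ∀ n, 0 ≤ a n) (hasum : HasSum a 1)
    (hr : ∀ n, 0 ≤ r n) (hrs : Summable r) (hu : ∀ n, u n ∈ Set.Icc (0 : ℝ) 1)
    (hren : ∀ n, u (n + 1) = ∑ k ∈ Finset.range (n + 1), a k * u (n - k))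
    (htot : ∀ n, ∑ k ∈ Finset.range (n + 1), r k * u (n - k) = 1)
    {k : ℕ} (hk : a k ≠ 0) (hk' : a (k + 1) ≠ 0) :
    Tendsto u atTop (𝓝 (∑' n, r n)⁻¹) := by
  -- An extremal cluster point of `u`, the sign `s` telling which extreme, has the claimed value.
  have extremal : ∀ s : ℝ, s ≠ 0 → ∀ l, MapClusterPt l atTop u →
      (∀ l', MapClusterPt l' atTop u → s * l' ≤ s * l) → l = (∑' n, r n)⁻¹ := by
    intro s hs l hl hmax
    obtain ⟨F, hF, hFl⟩ := mapClusterPt_iff_ultrafilter.1 hl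
    have hex : ∀ d, ∃ x ∈ Set.Icc (0 : ℝ) 1, Tendsto (fun n => u (n - d)) F (𝓝 x) := fun d =>
      isCompact_Icc.ultrafilter_le_nhds' (F.map fun n => u (n - d))
        (Filter.mem_map.2 (Filter.univ_mem' fun n => hu _))
    choose v hv01 hv using hex
    have hv0 : v 0 = l := tendsto_nhds_unique (hv 0) hFl
    have hvmax : ∀ d, s * v d ≤ s * v 0 := fun d => by
      rw [hv0]
      exact hmax _ (MapClusterPt.of_comp ((tendsto_sub_atTop_nat d).mono_left hF)
        (hv d).mapClusterPt)
    have hharm : ∀ d, v d = ∑' k, a k * v (d + k + 1) := fun d => by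
      have h1 := tendsto_convolution_of_tendsto_shift hF hu ha hasum.summable hv (d + 1)
      have h2 := tendsto_nhds_unique (h1.congr' ?_) (hv d)
      · rw [← h2]
        exact tsum_congr fun k => by rw [add_right_comm]
      · filter_upwards [hF (eventually_ge_atTop (d + 1))] with n hn
        rw [← hren, show n - (d + 1) + 1 = n - d by omega]
    have hconst : ∀ d ≥ (k + 1) * (k + 1), v d = l := fun d hd => by
      have := eq_of_harmonic_of_le (v := fun d => s * v d) (C := |s|) ha hasum
        (fun d => by
          rw [abs_mul, abs_of_nonneg (hv01 d).1]
          exact mul_le_of_le_one_right (abs_nonneg s) (hv01 d).2)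
        (fun d => by
          rw [hharm d, ← tsum_mul_left]
          exact tsum_congr fun k => by ring)
        hvmax hk hk' hd
      rw [← hv0]
      exact mul_left_cancel₀ hs this
    have h1 := tendsto_convolution_of_tendsto_shift hF hu hr hrs hv ((k + 1) * (k + 1))
    simp only [htot] at h1
    have h2 := tendsto_nhds_unique h1 tendsto_const_nhds
    rw [tsum_congr fun j => by rw [hconst _ (Nat.le_add_right _ j)], tsum_mul_right] at h2
    exact eq_inv_of_mul_eq_one_right h2
  have hsub : ∀ l, MapClusterPt l atTop u → l ∈ Set.Icc (0 : ℝ) 1 := fun l hl =>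
    isClosed_Icc.mem_of_mapClusterPt hl (Eventually.of_forall hu)
  have hcompact : IsCompact {l | MapClusterPt l atTop u} :=
    isCompact_Icc.of_isClosed_subset isClosed_setOfPred_clusterPt hsub
  have hne : {l | MapClusterPt l atTop u}.Nonempty := by
    obtain ⟨l, -, hl⟩ := isCompact_Icc.exists_mapClusterPt (f := atTop) (u := u)
      (tendsto_principal.2 (Eventually.of_forall hu))
    exact ⟨l, hl⟩
  obtain ⟨M, hM, hMmax⟩ := hcompact.exists_isGreatest hne
  obtain ⟨m, hm, hmmin⟩ := hcompact.exists_isLeast hne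
  have hMe := extremal 1 one_ne_zero M hM fun l hl => by simpa using hMmax hl
  have hme := extremal (-1) (by norm_num) m hm fun l hl => by simpa using hmmin hl
  refine isCompact_Icc.le_nhds_of_unique_clusterPt
    (Filter.mem_map.2 (Filter.univ_mem' hu)) fun l _ hl => ?_
  exact le_antisymm (hMe ▸ hMmax hl) (hme ▸ hmmin hl)

section Convergence

variable {X : Type*} {K : X → PMF X} {T : Set X} {q : PMF X}

theorem visitProb_le_one (n : ℕ) : visitProb K T q n ≤ 1 := by
  cases n with
  | zero => exact le_rfl
  | succ n =>
    rw [visitProb, ← (chainDist K q n).tsum_coe]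
    exact ENNReal.tsum_le_tsum fun x => Set.indicator_le_self _ _ x

theorem visitProb_ne_top (n : ℕ) : visitProb K T q n ≠ ⊤ :=
  ne_top_of_le_ne_top ENNReal.one_ne_top (visitProb_le_one n)

theorem tsum_indicator_tabooMass_ne_top (n : ℕ) :
    ∑' x, T.indicator (tabooMass K T q n) x ≠ ⊤ :=
  ne_top_of_le_ne_top ENNReal.one_ne_top <| (ENNReal.tsum_le_tsum fun x =>
    Set.indicator_le_self _ _ x).trans (tsum_tabooMass_le_one n)

/-- The renewal equation, obtained from the last-visit decomposition by evaluating on `T`. -/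
theorem visitProb_succ_eq_sum (hK : ∀ x ∈ T, K x = q) (n : ℕ) :
    visitProb K T q (n + 1) = ∑ k ∈ Finset.range (n + 1),
      (∑' x, T.indicator (tabooMass K T q k) x) * visitProb K T q (n - k) := by
  rw [visitProb, chainDist_eq_sum hK]
  simp only [← ENNReal.tsum_mul_right]
  rw [← Summable.tsum_finsetSum fun _ _ => ENNReal.summable]
  refine tsum_congr fun x => ?_
  by_cases hx : x ∈ T <;> simp [hx, mul_comm]

theorem sum_tsum_tabooMass_mul_visitProb (hK : ∀ x ∈ T, K x = q) (n : ℕ) :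
    ∑ k ∈ Finset.range (n + 1),
      (∑' x, tabooMass K T q k x) * visitProb K T q (n - k) = 1 := by
  rw [← (chainDist K q n).tsum_coe, chainDist_eq_sum hK]
  simp only [← ENNReal.tsum_mul_right]
  rw [← Summable.tsum_finsetSum fun _ _ => ENNReal.summable]
  refine tsum_congr fun x => ?_
  simp [mul_comm]

/-- A regenerative chain whose return times to `T` have finite mean and charge two consecutive
integers converges to its cycle law. -/
theorem tendsto_chainDist_cycleLaw (hK : ∀ x ∈ T, K x = q) (hfin : cycleLength K T q ≠ ⊤)
    {k : ℕ} (hk : ∑' x, T.indicator (tabooMass K T q k) x ≠ 0)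
    (hk' : ∑' x, T.indicator (tabooMass K T q (k + 1)) x ≠ 0) (x : X) :
    Tendsto (fun n => chainDist K q n x) atTop (𝓝 (cycleLaw hfin x)) := by
  have hmass : ∀ n, ∑' x, tabooMass K T q n x ≠ ⊤ := fun n =>
    ne_top_of_le_ne_top ENNReal.one_ne_top (tsum_tabooMass_le_one n)
  have hu : ∀ n, (visitProb K T q n).toReal ∈ Set.Icc (0 : ℝ) 1 := fun n =>
    ⟨ENNReal.toReal_nonneg, by
      simpa using ENNReal.toReal_mono ENNReal.one_ne_top (visitProb_le_one n)⟩
  have hlim := tendsto_renewal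
    (a := fun n => (∑' x, T.indicator (tabooMass K T q n) x).toReal)
    (r := fun n => (∑' x, tabooMass K T q n x).toReal)
    (u := fun n => (visitProb K T q n).toReal) (fun _ => ENNReal.toReal_nonneg)
    (by
      have h1 := tsum_tsum_indicator_tabooMass hfin
      have h2 := ENNReal.hasSum_toReal (h1.trans_ne ENNReal.one_ne_top)
      rwa [← ENNReal.tsum_toReal_eq tsum_indicator_tabooMass_ne_top, h1,
        ENNReal.toReal_one] at h2)
    (fun _ => ENNReal.toReal_nonneg) (ENNReal.summable_toReal hfin) hu
    (fun n => by
      rw [visitProb_succ_eq_sum hK, ENNReal.toReal_sum fun k _ =>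
        ENNReal.mul_ne_top (tsum_indicator_tabooMass_ne_top k) (visitProb_ne_top _)]
      simp only [ENNReal.toReal_mul])
    (fun n => by
      have := congrArg ENNReal.toReal (sum_tsum_tabooMass_mul_visitProb hK n)
      rw [ENNReal.toReal_sum fun k _ =>
        ENNReal.mul_ne_top (hmass k) (visitProb_ne_top _)] at this
      simpa only [ENNReal.toReal_mul, ENNReal.toReal_one] using this)
    (ENNReal.toReal_ne_zero.2 ⟨hk, tsum_indicator_tabooMass_ne_top k⟩)
    (ENNReal.toReal_ne_zero.2 ⟨hk', tsum_indicator_tabooMass_ne_top _⟩)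
  have hshift := fun d => hlim.comp (tendsto_sub_atTop_nat d)
  have hconv := tendsto_convolution_of_tendsto_shift le_rfl hu
    (w := fun n => (tabooMass K T q n x).toReal) (fun _ => ENNReal.toReal_nonneg)
    (ENNReal.summable_toReal (cycleMass_ne_top hfin x)) hshift 0
  rw [tsum_mul_right, ← ENNReal.tsum_toReal_eq hmass,
    ← ENNReal.tsum_toReal_eq fun n => tabooMass_ne_top n x] at hconv
  rw [← ENNReal.tendsto_toReal_iff (fun n => (chainDist K q n).apply_ne_top x)
    ((cycleLaw hfin).apply_ne_top x), cycleLaw_apply, ENNReal.toReal_mul, ENNReal.toReal_inv]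
  refine hconv.congr fun n => ?_
  rw [chainDist_apply_eq_sum hK, ENNReal.toReal_sum fun k _ =>
    ENNReal.mul_ne_top (visitProb_ne_top _) (tabooMass_ne_top k x)]
  simp only [ENNReal.toReal_mul, Nat.sub_zero, mul_comm]

end Convergence

/-! ### The chain with detours through the null state -/

section Detour

variable {S : Type*}

theorem ENNReal.tsum_option_eq (h : Option S → ℝ≥0∞) :
    ∑' o, h o = h none + ∑' s, h (some s) := by
  rw [← (Equiv.optionEquivSumPUnit.{0} S).symm.tsum_eq,
    Summable.tsum_sum ENNReal.summable ENNReal.summable, add_comm]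
  simp

theorem PMF.map_some_apply_some (p : PMF S) (s : S) : p.map some (some s) = p s := by
  rw [PMF.map_apply, tsum_eq_single s fun b hb => if_neg fun h => hb (Option.some.inj h).symm]
  simp

theorem PMF.map_some_apply_none (p : PMF S) : p.map some none = 0 := by
  simp [PMF.map_apply]

variable {ε : ℝ} {hε : ε ∈ Set.Ioo (0 : ℝ) 1}

theorem PMF.detour_apply_none (p : PMF S) : p.detour ε hε none = ENNReal.ofReal ε := rfl

theorem PMF.detour_apply_some (p : PMF S) (s : S) :
    p.detour ε hε (some s) = ENNReal.ofReal (1 - ε) * p s := rfl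

theorem ENNReal.ofReal_one_sub_add_ofReal (hε : ε ∈ Set.Ioo (0 : ℝ) 1) :
    ENNReal.ofReal (1 - ε) + ENNReal.ofReal ε = 1 := by
  rw [← ENNReal.ofReal_add (by linarith [hε.2]) hε.1.le]
  simp

theorem PMF.tsum_map_some_mul (p : PMF S) (h : Option S → ℝ≥0∞) :
    ∑' o, p.map some o * h o = ∑' s, p s * h (some s) := by
  simp [ENNReal.tsum_option_eq, PMF.map_some_apply_some, PMF.map_some_apply_none, -PMF.map_apply]

/-- If the value at the null state is the expected value after the detour, then making the detour
does not change expectations. -/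
theorem PMF.tsum_detour_mul (p : PMF S) {h : Option S → ℝ≥0∞}
    (hh : h none = ∑' s, p s * h (some s)) :
    ∑' o, p.detour ε hε o * h o = ∑' s, p s * h (some s) := by
  rw [ENNReal.tsum_option_eq]
  simp only [PMF.detour_apply_none, PMF.detour_apply_some, mul_assoc, ENNReal.tsum_mul_left]
  rw [hh, ← add_mul, add_comm (ENNReal.ofReal ε), ENNReal.ofReal_one_sub_add_ofReal hε, one_mul]

variable (K : S → PMF S) (T : Set S) (q : PMF S) (hε)

open scoped Classical in
/-- The chain on `Option S` that moves like `K` on `S`, except that with probability `ε` its exit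
from `T` according to `q` is delayed by one step spent at `none`. -/
def detourChain : Option S → PMF (Option S)
  | none => q.map some
  | some s => if s ∈ T then q.detour ε hε else (K s).map some

variable {K T q}

theorem tsum_detourChain_some_mul (hK : ∀ s ∈ T, K s = q) {h : Option S → ℝ≥0∞}
    (hh : h none = ∑' s, q s * h (some s)) (s : S) :
    ∑' o, detourChain hε K T q (some s) o * h o = ∑' y, K s y * h (some y) := by
  by_cases hs : s ∈ T
  · simp only [detourChain, if_pos hs, hK s hs]
    exact q.tsum_detour_mul hh
  · simp only [detourChain, if_neg hs]
    exact (K s).tsum_map_some_mul h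

/-- Detours through a state with reward zero and discount factor one do not change expected
returns: both potentials solve the one-step equation of the other chain. -/
theorem potential_detourChain_some (hK : ∀ s ∈ T, K s = q) (g f : S → ℝ≥0∞) (s : S) :
    potential (detourChain hε K T q) (fun o => o.elim 1 g) (fun o => o.elim 0 f) (some s) =
      potential K g f s := by
  set P := potential (detourChain hε K T q) (fun o => o.elim 1 g) (fun o => o.elim 0 f)
  set U : Option S → ℝ≥0∞ := fun o => o.elim (∑' y, q y * potential K g f y) (potential K g f)
  apply le_antisymm
  · refine potential_le _ _ (U := U) (fun o => ?_) (some s)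
    cases o with
    | none =>
      simp only [weightedPull, detourChain, PMF.tsum_map_some_mul]
      simp [U]
    | some s =>
      rw [weightedPull, tsum_detourChain_some_mul hε hK (h := U) rfl]
      exact (potential_eq K g f s).ge
  · refine potential_le _ _ (U := fun s => P (some s)) (fun s => ?_) s
    have hnone : P none = ∑' y, q y * P (some y) := by
      conv_lhs => rw [show P none = _ from potential_eq _ _ _ _]
      simp only [weightedPull, detourChain, PMF.tsum_map_some_mul]
      simp [P]
    have hsome : P (some s) = f s + g s * ∑' o, detourChain hε K T q (some s) o * P o :=
      potential_eq _ _ _ _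
    rw [hsome, weightedPull, tsum_detourChain_some_mul hε hK (h := P) hnone]

theorem potential_detourChain_none (hK : ∀ s ∈ T, K s = q) (g f : S → ℝ≥0∞) :
    potential (detourChain hε K T q) (fun o => o.elim 1 g) (fun o => o.elim 0 f) none =
      ∑' y, q y * potential K g f y := by
  rw [potential_eq, weightedPull]
  simp only [detourChain, PMF.tsum_map_some_mul]
  simp [potential_detourChain_some hε hK]

theorem weightedPush_detourChain_none (m : Option S → ℝ≥0∞) :
    weightedPush (detourChain hε K T q) ((some '' T)ᶜ.indicator 1) m none = 0 := by
  rw [weightedPush_apply, ENNReal.tsum_option_eq]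
  simp only [detourChain, PMF.map_some_apply_none, mul_zero, zero_add, ENNReal.tsum_eq_zero]
  intro s
  by_cases hs : s ∈ T <;> simp [hs, PMF.map_some_apply_none, -PMF.map_apply]

theorem weightedPush_detourChain_some (m : Option S → ℝ≥0∞) (s : S) :
    weightedPush (detourChain hε K T q) ((some '' T)ᶜ.indicator 1) m (some s) =
      weightedPush K (Tᶜ.indicator 1) (fun s => m (some s)) s + m none * q s := by
  rw [weightedPush_apply, ENNReal.tsum_option_eq, weightedPush_apply, add_comm]
  congr 1
  · refine tsum_congr fun x => ?_
    by_cases hx : x ∈ T <;> simp [hx, detourChain, PMF.map_some_apply_some, -PMF.map_apply]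
  · simp [detourChain, PMF.map_some_apply_some, -PMF.map_apply]

theorem tabooMass_detourChain_zero_some (s : S) :
    tabooMass (detourChain hε K T q) (some '' T) (q.detour ε hε) 0 (some s) =
      ENNReal.ofReal (1 - ε) * tabooMass K T q 0 s := rfl

theorem tabooMass_detourChain_succ_none (n : ℕ) :
    tabooMass (detourChain hε K T q) (some '' T) (q.detour ε hε) (n + 1) none = 0 := by
  rw [tabooMass_succ, weightedPush_detourChain_none]

/-- An excursion of the chain with detours is an excursion of the original chain, delayed by one
step with probability `ε`. -/
theorem tabooMass_detourChain_succ_some (n : ℕ) (s : S) :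
    tabooMass (detourChain hε K T q) (some '' T) (q.detour ε hε) (n + 1) (some s) =
      ENNReal.ofReal (1 - ε) * tabooMass K T q (n + 1) s +
        ENNReal.ofReal ε * tabooMass K T q n s := by
  have hsmul : ∀ (c : ℝ≥0∞) (m : S → ℝ≥0∞) (s : S),
      weightedPush K (Tᶜ.indicator 1) (fun x => c * m x) s =
        c * weightedPush K (Tᶜ.indicator 1) m s := fun c m s =>
    congrFun (map_smul (weightedPush K (Tᶜ.indicator 1)) c m) s
  have hadd : ∀ (m m' : S → ℝ≥0∞) (s : S),
      weightedPush K (Tᶜ.indicator 1) (fun x => m x + m' x) s =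
        weightedPush K (Tᶜ.indicator 1) m s + weightedPush K (Tᶜ.indicator 1) m' s :=
    fun m m' s => congrFun (map_add (weightedPush K (Tᶜ.indicator 1)) m m') s
  induction n generalizing s with
  | zero =>
    rw [tabooMass_succ, weightedPush_detourChain_some]
    simp only [tabooMass_detourChain_zero_some]
    rw [hsmul, ← tabooMass_succ]
    rfl
  | succ n ih =>
    rw [tabooMass_succ, weightedPush_detourChain_some, tabooMass_detourChain_succ_none]
    simp only [ih]
    rw [hadd, hsmul, hsmul, ← tabooMass_succ, ← tabooMass_succ, zero_mul, add_zero]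

theorem cycleMass_detourChain_none :
    cycleMass (detourChain hε K T q) (some '' T) (q.detour ε hε) none = ENNReal.ofReal ε := by
  rw [cycleMass, tsum_eq_zero_add' ENNReal.summable]
  simp only [tabooMass_detourChain_succ_none, tsum_zero, add_zero]
  rfl

theorem cycleMass_detourChain_some (s : S) :
    cycleMass (detourChain hε K T q) (some '' T) (q.detour ε hε) (some s) =
      cycleMass K T q s := by
  rw [cycleMass, tsum_eq_zero_add' ENNReal.summable, tabooMass_detourChain_zero_some]
  simp only [tabooMass_detourChain_succ_some]
  rw [ENNReal.tsum_add, ← add_assoc, ENNReal.tsum_mul_left, ENNReal.tsum_mul_left, ← mul_add,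
    ← tsum_eq_zero_add' (f := fun n => tabooMass K T q n s) ENNReal.summable, ← add_mul,
    ENNReal.ofReal_one_sub_add_ofReal hε, one_mul, cycleMass]

theorem cycleLength_detourChain :
    cycleLength (detourChain hε K T q) (some '' T) (q.detour ε hε) =
      ENNReal.ofReal ε + cycleLength K T q := by
  rw [← tsum_cycleMass, ENNReal.tsum_option_eq, cycleMass_detourChain_none, ← tsum_cycleMass]
  simp only [cycleMass_detourChain_some]

theorem cycleLength_detourChain_ne_top (hfin : cycleLength K T q ≠ ⊤) :
    cycleLength (detourChain hε K T q) (some '' T) (q.detour ε hε) ≠ ⊤ := by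
  rw [cycleLength_detourChain]
  exact ENNReal.add_ne_top.2 ⟨ENNReal.ofReal_ne_top, hfin⟩

/-- The random delay makes the return times aperiodic, whatever the original return times. -/
theorem exists_consecutive_return_detourChain (hfin : cycleLength K T q ≠ ⊤) :
    ∃ k, ∀ j ∈ ({k, k + 1} : Set ℕ), ∑' o, (some '' T).indicator
      (tabooMass (detourChain hε K T q) (some '' T) (q.detour ε hε) j) o ≠ 0 := by
  have hpos : ENNReal.ofReal ε ≠ 0 := (ENNReal.ofReal_pos.2 hε.1).ne'
  have hpos' : ENNReal.ofReal (1 - ε) ≠ 0 := (ENNReal.ofReal_pos.2 (by linarith [hε.2])).ne'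
  have h1 : ∑' n, ∑' x, T.indicator (tabooMass K T q n) x ≠ 0 := by
    rw [tsum_tsum_indicator_tabooMass hfin]
    exact one_ne_zero
  simp only [ne_eq, ENNReal.tsum_eq_zero, not_forall] at h1
  obtain ⟨k, s, hs⟩ := h1
  obtain ⟨hsT, hs⟩ : s ∈ T ∧ tabooMass K T q k s ≠ 0 := by
    by_cases h : s ∈ T <;> simp_all
  have key : ∀ j, tabooMass (detourChain hε K T q) (some '' T) (q.detour ε hε) j (some s) ≠ 0 →
      ∑' o, (some '' T).indicator
        (tabooMass (detourChain hε K T q) (some '' T) (q.detour ε hε) j) o ≠ 0 := by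
    intro j hj h0
    have := ENNReal.tsum_eq_zero.1 h0 (some s)
    rw [Set.indicator_of_mem (Set.mem_image_of_mem some hsT)] at this
    exact hj this
  refine ⟨k, ?_⟩
  rintro j (rfl | rfl)
  · refine key _ ?_
    cases j with
    | zero => exact mul_ne_zero hpos' hs
    | succ n =>
      rw [tabooMass_detourChain_succ_some]
      exact fun h => mul_ne_zero hpos' hs (add_eq_zero.1 h).1
  · refine key _ ?_
    rw [tabooMass_detourChain_succ_some]
    exact fun h => mul_ne_zero hpos hs (add_eq_zero.1 h).2

theorem detourChain_of_mem {o : Option S} (ho : o ∈ some '' T) :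
    detourChain hε K T q o = q.detour ε hε := by
  obtain ⟨s, hs, rfl⟩ := ho
  simp [detourChain, hs]

/-- The two cycle laws differ by the mass of the null state only. -/
theorem cycleLaw_toReal_eq_div (hfin : cycleLength K T q ≠ ⊤) :
    (cycleLaw (cycleLength_detourChain_ne_top hε hfin) none).toReal < 1 ∧
      ∀ s, (cycleLaw hfin s).toReal =
        (cycleLaw (cycleLength_detourChain_ne_top hε hfin) (some s)).toReal /
          (1 - (cycleLaw (cycleLength_detourChain_ne_top hε hfin) none).toReal) := by
  have hL : 0 < (cycleLength K T q).toReal := ENNReal.toReal_pos cycleLength_ne_zero hfin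
  simp only [cycleLaw_apply, cycleMass_detourChain_none, cycleMass_detourChain_some,
    cycleLength_detourChain, ENNReal.toReal_mul, ENNReal.toReal_inv,
    ENNReal.toReal_add ENNReal.ofReal_ne_top hfin, ENNReal.toReal_ofReal hε.1.le]
  have hε0 := hε.1
  have hsum : 0 < ε + (cycleLength K T q).toReal := by positivity
  constructor
  · rw [← div_eq_mul_inv, div_lt_one hsum]
    linarith
  · intro s
    have : 1 - ε * (ε + (cycleLength K T q).toReal)⁻¹ =
        (cycleLength K T q).toReal * (ε + (cycleLength K T q).toReal)⁻¹ := by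
      field_simp
      ring
    rw [this]
    field_simp

end Detour

/-! ### Episodes and the expected cycle length -/

section Cycle

variable {X : Type*} {K : X → PMF X} {T : Set X} {q : PMF X}

/-- If the return to `T` is certain, then the probability that it takes more than `n` steps is the
sum of the return probabilities at later times, and summing over `n` gives the mean. -/
theorem cycleLength_eq_tsum_mul
    (h1 : ∑' n, ∑' x, T.indicator (tabooMass K T q n) x = 1) :
    cycleLength K T q =
      ∑' n : ℕ, (∑' x, T.indicator (tabooMass K T q n) x) * ((n + 1 : ℕ) : ℝ≥0∞) := by
  set a : ℕ → ℝ≥0∞ := fun n => ∑' x, T.indicator (tabooMass K T q n) x with ha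
  have htail : ∀ n, ∑' x, tabooMass K T q n x = ∑' j, if n ≤ j then a j else 0 := by
    intro n
    have hne : ∑ k ∈ Finset.range n, a k ≠ ⊤ :=
      ENNReal.sum_ne_top.2 fun k _ => tsum_indicator_tabooMass_ne_top k
    refine (ENNReal.add_left_inj hne).1 ?_
    rw [tsum_tabooMass_add_sum, ← h1,
      show ∑ k ∈ Finset.range n, a k = ∑' j, if n ≤ j then 0 else a j by
        rw [tsum_eq_sum (s := Finset.range n) fun j hj => if_pos (by simpa using hj)]
        exact Finset.sum_congr rfl fun j hj => (if_neg (by simpa using hj)).symm,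
      ← ENNReal.tsum_add]
    refine tsum_congr fun j => ?_
    split_ifs <;> simp [ha]
  rw [cycleLength]
  simp only [htail]
  rw [ENNReal.tsum_comm]
  refine tsum_congr fun j => ?_
  rw [tsum_eq_sum (s := Finset.range (j + 1)) fun n hn => if_neg (by simpa using hn),
    Finset.sum_congr rfl fun n hn => if_pos (by simpa [Nat.lt_succ_iff] using hn)]
  simp [ha, mul_comm]

variable (K T) in
/-- The probability that the chain `K` with initial distribution `μ` follows the path `p`, or
zero if an intermediate state of `p` is in `T`. -/
def pathWeight (μ : PMF X) (n : ℕ) (p : Fin (n + 2) → X) : ℝ≥0∞ :=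
  μ (p 0) * (∏ i : Fin n, Tᶜ.indicator 1 (p i.succ.castSucc)) *
    ∏ i : Fin (n + 1), K (p i.castSucc) (p i.succ)

theorem pathWeight_snoc (μ : PMF X) (n : ℕ) (p : Fin (n + 2) → X) (y : X) :
    pathWeight K T μ (n + 1) (Fin.snoc p y : Fin (n + 3) → X) =
      pathWeight K T μ n p *
        (Tᶜ.indicator 1 (p (Fin.last (n + 1))) * K (p (Fin.last (n + 1))) y) := by
  have h0 : (Fin.snoc p y : Fin (n + 3) → X) 0 = p 0 :=
    Fin.snoc_castSucc (α := fun _ => X) (i := (0 : Fin (n + 2))) ..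
  have hc : ∀ i : Fin (n + 2), (Fin.snoc p y : Fin (n + 3) → X) i.castSucc = p i :=
    fun i => Fin.snoc_castSucc ..
  have hl : (Fin.snoc p y : Fin (n + 3) → X) (Fin.last (n + 2)) = y := Fin.snoc_last ..
  rw [pathWeight, pathWeight, Fin.prod_univ_castSucc, Fin.prod_univ_castSucc (n := n + 1)]
  simp only [h0, hc, Fin.succ_castSucc, Fin.succ_last, hl]
  ring

/-- Summation over paths computes the taboo masses. -/
theorem tsum_pathWeight_mul {μ : PMF X} (hμ : μ.bind K = q) (n : ℕ) (h : X → ℝ≥0∞) :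
    ∑' p : Fin (n + 2) → X, pathWeight K T μ n p * h (p (Fin.last (n + 1))) =
      ∑' x, tabooMass K T q n x * h x := by
  induction n generalizing h with
  | zero =>
    rw [← (finTwoArrowEquiv X).symm.tsum_eq, ENNReal.tsum_prod', ENNReal.tsum_comm]
    refine tsum_congr fun y => ?_
    rw [tabooMass_zero, ← hμ, PMF.bind_apply, ← ENNReal.tsum_mul_right]
    refine tsum_congr fun x => ?_
    simp [pathWeight]
  | succ n ih =>
    rw [← (Fin.snocEquiv fun _ => X).tsum_eq, ENNReal.tsum_prod', ENNReal.tsum_comm,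
      tabooMass_succ, tsum_weightedPush_mul, ← ih]
    refine tsum_congr fun p => ?_
    rw [weightedPull, ← ENNReal.tsum_mul_left, ← ENNReal.tsum_mul_left]
    refine tsum_congr fun y => ?_
    change pathWeight K T μ (n + 1) (Fin.snoc p y : Fin (n + 3) → X) *
      h ((Fin.snoc p y : Fin (n + 3) → X) (Fin.last (n + 2))) = _
    rw [pathWeight_snoc, Fin.snoc_last]
    ring

end Cycle

namespace MDP

variable {S A : Type*} {M : MDP S A}

/-- Episodes as paths, graded by their number of transitions minus one. -/
def episodeEquiv : (Σ n : ℕ, {p : Fin (n + 2) → S // p 0 ∈ M.terminals ∧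
    p (Fin.last (n + 1)) ∈ M.terminals ∧
    ∀ i, 0 < i → i < Fin.last (n + 1) → p i ∉ M.terminals}) ≃ M.Episode where
  toFun x := ⟨x.1 + 1, x.1.succ_pos, x.2.1, x.2.2.1, x.2.2.2.1, x.2.2.2.2⟩
  invFun
    | ⟨n + 1, _, p, h0, hl, hm⟩ => ⟨n, p, h0, hl, hm⟩
  left_inv _ := rfl
  right_inv
    | ⟨_ + 1, _, _, _, _, _⟩ => rfl

theorem init_support_subset_terminals (h : M.Homogeneous) : M.init.support ⊆ M.terminals :=
  fun s hs s' hs' => h s hs s' hs'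

theorem tsum_episodeProb_mul (h : M.Homogeneous) (π : S → PMF A) (φ : ℕ → ℝ≥0∞) {q : PMF S}
    (hq : M.init.bind (M.chain π) = q) :
    ∑' ξ, M.episodeProb π ξ * φ ξ.length =
      ∑' n, (∑' x, M.terminals.indicator (tabooMass (M.chain π) M.terminals q n) x) *
        φ (n + 1) := by
  rw [← episodeEquiv.tsum_eq, ENNReal.tsum_sigma']
  refine tsum_congr fun n => ?_
  have h1 := tsum_pathWeight_mul (T := M.terminals) hq n (M.terminals.indicator 1)
  have h2 : ∀ x, tabooMass (M.chain π) M.terminals q n x * M.terminals.indicator 1 x =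
      M.terminals.indicator (tabooMass (M.chain π) M.terminals q n) x := fun x => by
    by_cases hx : x ∈ M.terminals <;> simp [hx]
  simp only [h2] at h1
  rw [← h1, ← ENNReal.tsum_mul_right]
  set C : Set (Fin (n + 2) → S) := {p | p 0 ∈ M.terminals ∧
    p (Fin.last (n + 1)) ∈ M.terminals ∧
    ∀ i, 0 < i → i < Fin.last (n + 1) → p i ∉ M.terminals} with hC
  set w : (Fin (n + 2) → S) → ℝ≥0∞ := fun p =>
    M.init (p 0) * (∏ i : Fin (n + 1), M.chain π (p i.castSucc) (p i.succ)) * φ (n + 1) with hw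
  refine (tsum_subtype C w).trans (tsum_congr fun p => ?_)
  by_cases hp : p ∈ C
  · have hmid : ∏ i : Fin n, M.terminalsᶜ.indicator (1 : S → ℝ≥0∞) (p i.succ.castSucc) = 1 :=
      Finset.prod_eq_one fun i _ => by
        rw [Set.indicator_of_mem]
        · rfl
        · exact hp.2.2 _ (by simp [Fin.lt_def]) (by simp [Fin.lt_def])
    rw [Set.indicator_of_mem hp, pathWeight, hmid, Set.indicator_of_mem hp.2.1]
    simp [hw]
  · rw [Set.indicator_of_notMem hp]
    symm
    by_cases h0 : M.init (p 0) = 0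
    · simp [pathWeight, h0]
    by_cases hl : p (Fin.last (n + 1)) ∈ M.terminals
    · have hmid : ∃ i, 0 < i ∧ i < Fin.last (n + 1) ∧ p i ∈ M.terminals := by
        by_contra! hcon
        exact hp ⟨init_support_subset_terminals h h0, hl, hcon⟩
      obtain ⟨i, hi0, hil, hi⟩ := hmid
      obtain ⟨j, rfl⟩ : ∃ j : Fin n, j.succ.castSucc = i := by
        refine ⟨⟨i - 1, ?_⟩, ?_⟩
        · simp only [Fin.lt_def, Fin.val_zero, Fin.val_last] at hi0 hil
          omega
        · ext
          simp only [Fin.lt_def, Fin.val_zero] at hi0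
          simp
          omega
      have hmid : ∏ i : Fin n, M.terminalsᶜ.indicator (1 : S → ℝ≥0∞) (p i.succ.castSucc) = 0 :=
        Finset.prod_eq_zero (Finset.mem_univ j) (Set.indicator_of_notMem (Set.notMem_compl_iff.2 hi) _)
      rw [pathWeight, hmid]
      simp
    · simp [hl]

theorem IsEpisodic.cycleLength_ne_top (hM : M.IsEpisodic) (π : S → PMF A) {q : PMF S}
    (hq : M.init.bind (M.chain π) = q) :
    cycleLength (M.chain π) M.terminals q ≠ ⊤ := by
  have h1 := hM.sum_prob π
  have h2 := hM.finite_length π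
  have h3 := tsum_episodeProb_mul hM.homogeneous π (fun _ => 1) hq
  simp only [mul_one] at h3
  rw [cycleLength_eq_tsum_mul (h3.symm.trans h1)]
  rw [tsum_episodeProb_mul hM.homogeneous π (fun n => (n : ℝ≥0∞)) hq] at h2
  exact h2.ne

end MDP

/-! ### Values as potentials -/

theorem tsum_eq_toReal_sub_toReal {x : ℕ → ℝ} (hx : ∑' n, ‖x n‖ₑ ≠ ⊤) :
    ∑' n, x n = (∑' n, ENNReal.ofReal (x n)).toReal - (∑' n, ENNReal.ofReal (-x n)).toReal := by
  have h1 : ∑' n, ENNReal.ofReal (x n) ≠ ⊤ :=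
    ne_top_of_le_ne_top hx (ENNReal.tsum_le_tsum fun n => Real.ofReal_le_enorm _)
  have h2 : ∑' n, ENNReal.ofReal (-x n) ≠ ⊤ :=
    ne_top_of_le_ne_top hx (ENNReal.tsum_le_tsum fun n => by
      simpa using Real.ofReal_le_enorm (-x n))
  rw [ENNReal.tsum_toReal_eq fun _ => ENNReal.ofReal_ne_top,
    ENNReal.tsum_toReal_eq fun _ => ENNReal.ofReal_ne_top,
    ← (ENNReal.summable_toReal h1).tsum_sub (ENNReal.summable_toReal h2)]
  refine tsum_congr fun n => ?_
  rw [ENNReal.toReal_ofReal', ENNReal.toReal_ofReal', max_comm, max_comm (-x n)]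
  exact (max_zero_sub_max_neg_zero_eq_self (x n)).symm.trans (by simp [max_comm])

namespace MDP

section Value

variable {S A : Type*} (M : MDP S A) (π : S → PMF A) {γ : S → ℝ}

theorem enorm_returnTerm (hγ : ∀ s, 0 ≤ γ s) (ω : ℕ → S) (t : ℕ) :
    ‖M.returnTerm γ ω t‖ₑ =
      (∏ τ ∈ Finset.range t, ENNReal.ofReal (γ (ω τ))) * ‖M.reward (ω t)‖ₑ := by
  rw [returnTerm, enorm_mul, mul_comm, ← ENNReal.ofReal_prod_of_nonneg fun τ _ => hγ (ω τ),
    Real.enorm_of_nonneg (Finset.prod_nonneg fun τ _ => hγ (ω τ))]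

theorem ofReal_returnTerm (hγ : ∀ s, 0 ≤ γ s) (ω : ℕ → S) (t : ℕ) :
    ENNReal.ofReal (M.returnTerm γ ω t) =
      (∏ τ ∈ Finset.range t, ENNReal.ofReal (γ (ω τ))) * ENNReal.ofReal (M.reward (ω t)) := by
  rw [returnTerm, mul_comm, ENNReal.ofReal_mul (Finset.prod_nonneg fun τ _ => hγ (ω τ)),
    ENNReal.ofReal_prod_of_nonneg fun τ _ => hγ (ω τ)]

theorem ofReal_neg_returnTerm (hγ : ∀ s, 0 ≤ γ s) (ω : ℕ → S) (t : ℕ) :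
    ENNReal.ofReal (-M.returnTerm γ ω t) =
      (∏ τ ∈ Finset.range t, ENNReal.ofReal (γ (ω τ))) * ENNReal.ofReal (-M.reward (ω t)) := by
  rw [returnTerm, ← neg_mul, mul_comm,
    ENNReal.ofReal_mul (Finset.prod_nonneg fun τ _ => hγ (ω τ)),
    ENNReal.ofReal_prod_of_nonneg fun τ _ => hγ (ω τ)]

variable [Countable S]

theorem lintegral_tsum_prod_mul_eq [MeasurableSpace S] [DiscreteMeasurableSpace S] (γ : S → ℝ)
    (f : S → ℝ≥0∞) (s : S) (a : A) :
    ∫⁻ ω, ∑' t, (∏ τ ∈ Finset.range t, ENNReal.ofReal (γ (ω τ))) * f (ω t)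
        ∂chainLaw (M.trans s a) (M.chain π) =
      ∑' x, M.trans s a x * potential (M.chain π) (fun x => ENNReal.ofReal (γ x)) f x :=
  lintegral_chainLaw_tsum _ _ (fun x => ENNReal.ofReal (γ x)) f

theorem valueDefined_iff (hγ : ∀ s, 0 ≤ γ s) (s : S) (a : A) :
    M.ValueDefined π γ s a ↔
      ∑' x, M.trans s a x * potential (M.chain π) (fun x => ENNReal.ofReal (γ x))
        (fun x => ‖M.reward x‖ₑ) x < ⊤ := by
  let _ : MeasurableSpace S := ⊤
  have : DiscreteMeasurableSpace S := ⟨fun _ => trivial⟩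
  rw [← lintegral_tsum_prod_mul_eq, ValueDefined]
  simp only [M.enorm_returnTerm hγ]

/-- A well-defined value is the difference of the potentials of the positive and the negative
part of the reward. -/
theorem value_eq (hγ : ∀ s, 0 ≤ γ s) (s : S) (a : A) (hdef : M.ValueDefined π γ s a) :
    M.value π γ s a =
      (∑' x, M.trans s a x * potential (M.chain π) (fun x => ENNReal.ofReal (γ x))
        (fun x => ENNReal.ofReal (M.reward x)) x).toReal -
      (∑' x, M.trans s a x * potential (M.chain π) (fun x => ENNReal.ofReal (γ x))
        (fun x => ENNReal.ofReal (-M.reward x)) x).toReal := by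
  let _ : MeasurableSpace S := ⊤
  have : DiscreteMeasurableSpace S := ⟨fun _ => trivial⟩
  rw [ValueDefined] at hdef
  rw [← lintegral_tsum_prod_mul_eq, ← lintegral_tsum_prod_mul_eq, value]
  simp only [← M.ofReal_returnTerm hγ, ← M.ofReal_neg_returnTerm hγ]
  set P := chainLaw (M.trans s a) (M.chain π)
  have hterm : ∀ t, Measurable fun ω : ℕ → S => M.returnTerm γ ω t := fun t => by
    have hγm : Measurable γ := measurable_of_countable γ
    have hR : Measurable M.reward := measurable_of_countable _
    unfold returnTerm
    fun_prop
  have hpos : Measurable fun ω => ∑' t, ENNReal.ofReal (M.returnTerm γ ω t) :=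
    Measurable.tsum fun t => (hterm t).ennreal_ofReal
  have hneg : Measurable fun ω => ∑' t, ENNReal.ofReal (-M.returnTerm γ ω t) :=
    Measurable.tsum fun t => (hterm t).neg.ennreal_ofReal
  have habs : Measurable fun ω => ∑' t, ‖M.returnTerm γ ω t‖ₑ :=
    Measurable.tsum fun t => (hterm t).enorm
  have hpos_top : ∫⁻ ω, ∑' t, ENNReal.ofReal (M.returnTerm γ ω t) ∂P ≠ ⊤ :=
    ne_top_of_le_ne_top hdef.ne (lintegral_mono fun ω => ENNReal.tsum_le_tsum fun t =>
      Real.ofReal_le_enorm _)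
  have hneg_top : ∫⁻ ω, ∑' t, ENNReal.ofReal (-M.returnTerm γ ω t) ∂P ≠ ⊤ :=
    ne_top_of_le_ne_top hdef.ne (lintegral_mono fun ω => ENNReal.tsum_le_tsum fun t => by
      simpa using Real.ofReal_le_enorm (-M.returnTerm γ ω t))
  rw [← integral_toReal hpos.aemeasurable (ae_lt_top hpos hpos_top),
    ← integral_toReal hneg.aemeasurable (ae_lt_top hneg hneg_top),
    ← integral_sub (integrable_toReal_of_lintegral_ne_top hpos.aemeasurable hpos_top)
      (integrable_toReal_of_lintegral_ne_top hneg.aemeasurable hneg_top)]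
  refine integral_congr_ae ?_
  filter_upwards [ae_lt_top habs hdef.ne] with ω hω
  exact tsum_eq_toReal_sub_toReal hω.ne

end Value

/-! ### The perturbed model as a chain with detours -/

section Perturbed

variable {S A : Type*} (M : MDP S A) {s₀ : S} (π : S → PMF A)

theorem trans_eq_chain_of_mem_terminals (hs₀ : s₀ ∈ M.init.support) {s : S}
    (hs : s ∈ M.terminals) (h₀ : s₀ ∈ M.terminals) (a : A) : M.trans s a = M.chain π s₀ := by
  have h : M.trans s₀ = fun _ => M.trans s a :=
    funext fun a' => (h₀ s₀ hs₀ a' a').trans (hs s₀ hs₀ a a').symm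
  rw [chain, h, PMF.bind_const]

theorem chain_eq_of_mem_terminals (hs₀ : s₀ ∈ M.init.support) {s : S}
    (hs : s ∈ M.terminals) (h₀ : s₀ ∈ M.terminals) : M.chain π s = M.chain π s₀ := by
  have h : M.trans s = fun _ => M.chain π s₀ :=
    funext fun a => M.trans_eq_chain_of_mem_terminals π hs₀ hs h₀ a
  rw [chain, h, PMF.bind_const]

variable {ε : ℝ} (hε : ε ∈ Set.Ioo (0 : ℝ) 1)

theorem chain_perturbed (hM : M.Homogeneous) (hs₀ : s₀ ∈ M.init.support)
    {π : S → PMF A} {π' : Option S → PMF A} (hπ : ∀ s, π' (some s) = π s) :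
    (M.perturbed ε hε s₀).chain π' =
      detourChain hε (M.chain π) M.terminals (M.chain π s₀) := by
  have h₀ := M.init_support_subset_terminals hM hs₀
  funext o
  cases o with
  | none =>
    have h : (M.perturbed ε hε s₀).trans none = fun _ => (M.chain π s₀).map some :=
      funext fun a => congrArg (PMF.map some) (M.trans_eq_chain_of_mem_terminals π hs₀ h₀ h₀ a)
    rw [chain, h, PMF.bind_const, detourChain]
  | some s =>
    by_cases hs : s ∈ M.terminals
    · have h : (M.perturbed ε hε s₀).trans (some s) = fun _ => (M.chain π s₀).detour ε hε :=
        funext fun a => by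
          rw [← M.trans_eq_chain_of_mem_terminals π hs₀ hs h₀ a]
          exact if_pos hs
      rw [chain, h, PMF.bind_const, detourChain, if_pos hs]
    · have h : (M.perturbed ε hε s₀).trans (some s) = fun a => (M.trans s a).map some :=
        funext fun a => if_neg hs
      rw [chain, h, hπ, detourChain, if_neg hs, chain, PMF.map_bind]

theorem tsum_trans_perturbed_mul (hM : M.Homogeneous) (hs₀ : s₀ ∈ M.init.support)
    {h : Option S → ℝ≥0∞}
    (hh : h none = ∑' y, M.chain π s₀ y * h (some y)) (s : S) (a : A) :
    ∑' o, (M.perturbed ε hε s₀).trans (some s) a o * h o =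
      ∑' y, M.trans s a y * h (some y) := by
  by_cases hs : s ∈ M.terminals
  · have h1 : (M.perturbed ε hε s₀).trans (some s) a = (M.trans s a).detour ε hε := if_pos hs
    rw [h1, PMF.tsum_detour_mul]
    rw [hh, M.trans_eq_chain_of_mem_terminals π hs₀ hs
      (M.init_support_subset_terminals hM hs₀)]
  · have h1 : (M.perturbed ε hε s₀).trans (some s) a = (M.trans s a).map some := if_neg hs
    rw [h1, PMF.tsum_map_some_mul]

/-- Expected returns are the same in the perturbed model. -/
theorem tsum_trans_perturbed_mul_potential (hM : M.Homogeneous) (hs₀ : s₀ ∈ M.init.support)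
    {π : S → PMF A} {π' : Option S → PMF A} (hπ : ∀ s, π' (some s) = π s) (g f : S → ℝ≥0∞) (s : S) (a : A) :
    ∑' o, (M.perturbed ε hε s₀).trans (some s) a o *
        potential ((M.perturbed ε hε s₀).chain π') (fun o => o.elim 1 g)
          (fun o => o.elim 0 f) o =
      ∑' y, M.trans s a y * potential (M.chain π) g f y := by
  have hK : ∀ s ∈ M.terminals, M.chain π s = M.chain π s₀ := fun s hs =>
    M.chain_eq_of_mem_terminals π hs₀ hs (M.init_support_subset_terminals hM hs₀)
  rw [M.chain_perturbed hε hM hs₀ hπ, M.tsum_trans_perturbed_mul π hε hM hs₀]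
  · simp only [potential_detourChain_some hε hK]
  · simp only [potential_detourChain_some hε hK, potential_detourChain_none hε hK]

theorem value_perturbed [Countable S] {π : S → PMF A} {π' : Option S → PMF A}
    (hM : M.Homogeneous) (hs₀ : s₀ ∈ M.init.support)
    (hπ : ∀ s, π' (some s) = π s) {γ : S → ℝ} (hγ : ∀ s, 0 ≤ γ s) (s : S) (a : A) :
    (M.ValueDefined π γ s a ↔
      (M.perturbed ε hε s₀).ValueDefined π' (fun o => o.elim 1 γ) (some s) a) ∧
    (M.ValueDefined π γ s a →
      M.value π γ s a =
        (M.perturbed ε hε s₀).value π' (fun o => o.elim 1 γ) (some s) a) := by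
  have hγ' : ∀ o : Option S, 0 ≤ o.elim 1 γ := fun o => by
    cases o with
    | none => exact zero_le_one
    | some s => exact hγ s
  have hg : (fun o : Option S => ENNReal.ofReal (o.elim 1 γ)) =
      fun o => o.elim 1 fun s => ENNReal.ofReal (γ s) := funext fun o => by
    cases o <;> simp
  have hf : ∀ φ : ℝ → ℝ≥0∞, φ 0 = 0 →
      (fun o => φ ((M.perturbed ε hε s₀).reward o)) = fun o => o.elim 0 fun s => φ (M.reward s) :=
    fun φ hφ => funext fun o => by
      cases o with
      | none => exact hφ
      | some s => rfl
  have hiff : M.ValueDefined π γ s a ↔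
      (M.perturbed ε hε s₀).ValueDefined π' (fun o => o.elim 1 γ) (some s) a := by
    rw [M.valueDefined_iff π hγ, (M.perturbed ε hε s₀).valueDefined_iff π' hγ', hg,
      hf (fun x => ‖x‖ₑ) enorm_zero, M.tsum_trans_perturbed_mul_potential hε hM hs₀ hπ]
  refine ⟨hiff, fun hdef => ?_⟩
  rw [M.value_eq π hγ s a hdef,
    (M.perturbed ε hε s₀).value_eq π' hγ' (some s) a (hiff.1 hdef), hg,
    hf (fun x => ENNReal.ofReal x) ENNReal.ofReal_zero,
    hf (fun x => ENNReal.ofReal (-x)) (by simp),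
    M.tsum_trans_perturbed_mul_potential hε hM hs₀ hπ,
    M.tsum_trans_perturbed_mul_potential hε hM hs₀ hπ]

end Perturbed

/-! ### Steady states and limiting distributions -/

section Steady

variable {S A : Type*} {M : MDP S A} {π : S → PMF A} {T : Set S} {q : PMF S}

theorem init_bind_chain_eq (hK : ∀ s ∈ T, M.chain π s = q) (hT : M.init.support ⊆ T) :
    M.init.bind (M.chain π) = q := by
  ext y
  rw [PMF.bind_apply]
  calc ∑' x, M.init x * M.chain π x y = ∑' x, M.init x * q y := tsum_congr fun x => by
        by_cases hx : M.init x = 0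
        · simp [hx]
        · rw [hK x (hT hx)]
    _ = q y := by rw [ENNReal.tsum_mul_right, PMF.tsum_coe, one_mul]

theorem marginal_succ_eq_chainDist (hq : M.init.bind (M.chain π) = q) (t : ℕ) :
    M.marginal π (t + 1) = chainDist (M.chain π) q t := by
  induction t with
  | zero => exact hq
  | succ t ih => rw [marginal, ih, chainDist]

theorem reachable_iff (hK : ∀ s ∈ T, M.chain π s = q) (hq : M.init.bind (M.chain π) = q)
    (s : S) : M.Reachable π s ↔ ∃ n, tabooMass (M.chain π) T q n s ≠ 0 := by
  rw [exists_tabooMass_ne_zero_iff hK]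
  constructor
  · rintro ⟨t, ht, h⟩
    obtain ⟨n, rfl⟩ := Nat.exists_eq_add_of_le' ht
    exact ⟨n, marginal_succ_eq_chainDist hq n ▸ h⟩
  · rintro ⟨n, h⟩
    exact ⟨n + 1, Nat.le_add_left 1 n, (marginal_succ_eq_chainDist hq n).symm ▸ h⟩

theorem isSteady_iff_eq_cycleLaw (hK : ∀ s ∈ T, M.chain π s = q)
    (hq : M.init.bind (M.chain π) = q) (hfin : cycleLength (M.chain π) T q ≠ ⊤) (μ : PMF S) :
    M.IsSteady π μ ↔ μ = cycleLaw hfin := by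
  constructor
  · rintro ⟨h1, h2⟩
    refine eq_cycleLaw_of_bind_eq hK hfin h1 fun s hs => h2 s fun hr => ?_
    obtain ⟨n, hn⟩ := (reachable_iff hK hq s).1 hr
    exact hn (hs n)
  · rintro rfl
    refine ⟨cycleLaw_bind hK hfin, fun s hs => cycleLaw_eq_zero hfin fun n => ?_⟩
    by_contra hn
    exact hs ((reachable_iff hK hq s).2 ⟨n, hn⟩)

theorem isLimiting_cycleLaw (hK : ∀ s ∈ T, M.chain π s = q)
    (hq : M.init.bind (M.chain π) = q) (hfin : cycleLength (M.chain π) T q ≠ ⊤) {k : ℕ}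
    (hk : ∑' x, T.indicator (tabooMass (M.chain π) T q k) x ≠ 0)
    (hk' : ∑' x, T.indicator (tabooMass (M.chain π) T q (k + 1)) x ≠ 0) :
    M.IsLimiting π (cycleLaw hfin) := fun s => by
  rw [← tendsto_add_atTop_iff_nat 1]
  simp only [marginal_succ_eq_chainDist hq]
  exact tendsto_chainDist_cycleLaw hK hfin hk hk' s

/-- A limiting distribution is steady: by Fatou's lemma it dominates its image under the chain,
and both have total mass one. -/
theorem IsLimiting.isSteady {μ : PMF S} (h : M.IsLimiting π μ) : M.IsSteady π μ := by
  have hle : ∀ y, μ.bind (M.chain π) y ≤ μ y := by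
    intro y
    rw [PMF.bind_apply, ENNReal.tsum_eq_iSup_sum]
    refine iSup_le fun F => ?_
    have h1 : Tendsto (fun t => ∑ x ∈ F, M.marginal π t x * M.chain π x y) atTop
        (𝓝 (∑ x ∈ F, μ x * M.chain π x y)) :=
      tendsto_finsetSum _ fun x _ => ENNReal.Tendsto.mul_const (h x)
        (Or.inr ((M.chain π x).apply_ne_top y))
    refine le_of_tendsto_of_tendsto' h1 ((h y).comp (tendsto_add_atTop_nat 1)) fun t => ?_
    exact ENNReal.sum_le_tsum F
  refine ⟨?_, fun s hs => ?_⟩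
  · ext y
    refine le_antisymm (hle y) ?_
    by_contra! hlt
    have := ENNReal.tsum_lt_tsum (μ.bind (M.chain π)).tsum_coe_ne_top hle hlt
    rw [PMF.tsum_coe, PMF.tsum_coe] at this
    exact lt_irrefl _ this
  · refine tendsto_nhds_unique (h s) (tendsto_const_nhds.congr' ?_)
    filter_upwards [eventually_ge_atTop 1] with t ht
    by_contra h0
    exact hs ⟨t, ht, fun h1 => h0 h1.symm⟩

end Steady

end MDP

theorem theorem3 {S A : Type*} [Countable S] [Countable A] (M : MDP S A) (hM : M.IsEpisodic)
    (ε : ℝ) (hε : ε ∈ Set.Ioo (0 : ℝ) 1) (s₀ : S) (hs₀ : s₀ ∈ M.init.support)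
    (π : S → PMF A) (π' : Option S → PMF A) (hπ : ∀ s, π' (some s) = π s) :
    -- the value functions agree on `S × A`, for every discounting function
    (∀ γ : S → ℝ, (∀ s, γ s ∈ Set.Icc (0 : ℝ) 1) → ∀ (s : S) (a : A),
      (M.ValueDefined π γ s a ↔
        (M.perturbed ε hε s₀).ValueDefined π' (fun o => o.elim 1 γ) (some s) a) ∧
      (M.ValueDefined π γ s a →
        M.value π γ s a =
          (M.perturbed ε hε s₀).value π' (fun o => o.elim 1 γ) (some s) a)) ∧
    -- the steady states exist, are unique, and are proportional on `S`
    ∃ (ρ : PMF S) (ρ' : PMF (Option S)),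
      (M.IsSteady π ρ ∧ ∀ μ, M.IsSteady π μ → μ = ρ) ∧
      (∀ μ, M.IsLimiting π μ → μ = ρ) ∧
      ((M.perturbed ε hε s₀).IsSteady π' ρ' ∧
        ∀ μ, (M.perturbed ε hε s₀).IsSteady π' μ → μ = ρ') ∧
      (M.perturbed ε hε s₀).IsLimiting π' ρ' ∧
      (ρ' none).toReal < 1 ∧
      ∀ s : S, (ρ s).toReal = (ρ' (some s)).toReal / (1 - (ρ' none).toReal) := by
  refine ⟨fun γ hγ s a => M.value_perturbed hε hM.homogeneous hs₀ hπ (fun s => (hγ s).1) s a, ?_⟩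
  have hT := MDP.init_support_subset_terminals hM.homogeneous
  have hK : ∀ s ∈ M.terminals, M.chain π s = M.chain π s₀ := fun s hs =>
    M.chain_eq_of_mem_terminals π hs₀ hs (hT hs₀)
  have hq := MDP.init_bind_chain_eq hK hT
  have hfin := hM.cycleLength_ne_top π hq
  have hchain := M.chain_perturbed hε hM.homogeneous hs₀ hπ
  have hK' : ∀ o ∈ some '' M.terminals,
      (M.perturbed ε hε s₀).chain π' o = (M.chain π s₀).detour ε hε := fun o ho => by
    rw [hchain, detourChain_of_mem hε ho]
  have hq' := MDP.init_bind_chain_eq (M := M.perturbed ε hε s₀) hK' (by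
    rw [MDP.perturbed, PMF.support_map]
    exact Set.image_mono hT)
  have hfin' : cycleLength ((M.perturbed ε hε s₀).chain π') (some '' M.terminals)
      ((M.chain π s₀).detour ε hε) ≠ ⊤ := by
    rw [hchain]
    exact cycleLength_detourChain_ne_top hε hfin
  have hlaw : cycleLaw hfin' = cycleLaw (cycleLength_detourChain_ne_top hε hfin) := by
    ext o
    rw [cycleLaw_apply, cycleLaw_apply, hchain]
  obtain ⟨k, hk⟩ := exists_consecutive_return_detourChain hε hfin
  rw [← hchain] at hk
  have hsteady := MDP.isSteady_iff_eq_cycleLaw hK hq hfin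
  have hsteady' := MDP.isSteady_iff_eq_cycleLaw hK' hq' hfin'
  refine ⟨cycleLaw hfin, cycleLaw hfin', ⟨(hsteady _).2 rfl, fun μ => (hsteady μ).1⟩,
    fun μ hμ => (hsteady μ).1 hμ.isSteady, ⟨(hsteady' _).2 rfl, fun μ => (hsteady' μ).1⟩,
    MDP.isLimiting_cycleLaw hK' hq' hfin' (hk k (by simp)) (hk (k + 1) (by simp)), ?_⟩
  rw [hlaw]
  exact cycleLaw_toReal_eq_div hε hfin

end
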